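/- **Setting.** Let $n,i\ge 0$. A finite simplicial complex $\Sigma$ on $[0,n]=\{0,\dots,n\}$ is a set of non-empty subsets of $[0,n]$ closed under passing to non-empty subsets; $\Sigma_p$ is the set of $\sigma\in\Sigma$ with $|\sigma|=p+1$. Let $C_\bullet(\Sigma)$ be the integral chain complex with basis $\Sigma$ and $\partial\{v_0<\dots<v_q\}=\sum_p(-1)^p\{v_0,\dots,\hat v_p,\dots,v_q\}$ (zero on vertices). On $C_\bullet(\Sigma)\otimes C_\bullet(\Sigma)$ put $\partial(x\otimes y)=\partial x\otimes y+(-1)^{|x|}x\otimes\partial y$ and $T(x\otimes y)=(-1)^{|x||y|}y\otimes x$. A set $U\subseteq\Sigma_{i+1}$ is *$\Sigma$-consistent* if for every $M\in\Sigma_{i+2}$ the set $\{M\setminus k: k\in M\}\cap U$ is a beginning or an ending segment of $\{M\setminus k:k\in M\}$ in the lexicographic order ($M\setminus k'<M\setminus k$ iff $k<k'$). For such $U$ and $\sigma\in\Sigma$ put $$\Delta_i^U(\sigma)=\sum_{L\subseteq\sigma,\ |L|=i+1}(-1)^{\varepsilon_L}\,(L\cup A_L)\otimes(L\cup B_L),$$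 where $A_L$ consists of those $a\in\sigma\setminus L$ such that either $L\cup\{a\}\in U$ and $|\{l\in L:l>a\}|$ is even, or $L\cup\{a\}\notin U$ and $|\{l\in L:l>a\}|$ is odd; $B_L=\sigma\setminus(L\cup A_L)$; and $\varepsilon_L=\sum_{b\in B_L}|\{a\in A_L:a<b\}|+\sum_{l\in L}|\{l'\in L:l'<l\}|+|\sigma||A_L|$. Extend $\Delta_i^U$ linearly to $C_\bullet(\Sigma)$, and put $\Delta_{-1}^\emptyset=0$. A *solution* is a linear map $\Delta\colon C_\bullet(\Sigma)\to C_\bullet(\Sigma)\otimes C_\bullet(\Sigma)$ such that $$\partial\circ\Delta-(-1)^i\,\Delta\circ\partial=(1+(-1)^iT)\,\Delta_{i-1}^\emptyset .\tag{$*$}$$ It is *normalised* if $i>0$, or $i=0$ and $\Delta(\sigma)=\sigma\otimes\sigma$ for all $\sigma\in\Sigma_0$; it is *local* if for every $\sigma\in\Sigma$ only terms $X\otimes Y$ with $X,Y\subseteq\sigma$ occur in $\Delta(\sigma)$. The number of terms of $\Delta(\sigma)$ is the number of basis elements $X\otimes Y$ ($X,Y\in\Sigma$) with non-zero coefficient.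 **Theorem 4.5.** 1. For every $\Sigma$-consistent $U\subseteq\Sigma_{i+1}$, the map $\Delta_i^U$ satisfies $(*)$. 2. Let $\Delta'$ be a normalised solution (not assumed local) such that, for every $\sigma\in\Sigma$, $\Delta'(\sigma)$ has at most as many terms as $\Delta''(\sigma)$ for every local normalised solution $\Delta''$. Then $\Delta'=\Delta_i^U$ for some $\Sigma$-consistent $U\subseteq\Sigma_{i+1}$. 3. The same conclusion holds if $\Delta'$ is a local normalised solution whose total number of terms, summed over all $\sigma\in\Sigma$, is minimal among local normalised solutions. -/

import Mathlib

noncomputable section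

namespace CupCoproduct

open scoped TensorProduct

variable {V : Type*} [LinearOrder V]

/-! ### Chains on a simplicial complex

A simplicial complex is a set of non-empty finite sets of vertices closed under passing to
non-empty subsets; not every vertex has to be a simplex. -/

/-- The chains on `K` with integer coefficients: all degrees together, with the simplices of `K`
as basis. -/
abbrev Chains (K : PreAbstractSimplicialComplex V) : Type _ := K.faces →₀ ℤ

/-- The dimension of a simplex. -/
def dim {K : PreAbstractSimplicialComplex V} (σ : K.faces) : ℕ := σ.1.card - 1

open Classical in
/-- The basis chain of a finite set of vertices; it is zero if the set is not a simplex of `K`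
(in particular if it is empty). -/
def chain (K : PreAbstractSimplicialComplex V) (s : Finset V) : Chains K :=
  if h : s ∈ K.faces then Finsupp.single ⟨s, h⟩ 1 else 0

/-- The boundary: the alternating sum of the faces obtained by removing one vertex. The sign
exponent is the position of the removed vertex, and the boundary of a vertex is zero. -/
def boundary (K : PreAbstractSimplicialComplex V) : Chains K →ₗ[ℤ] Chains K :=
  Finsupp.linearCombination ℤ fun σ : K.faces =>
    ∑ v ∈ σ.1, (-1 : ℤ) ^ (σ.1.filter (· < v)).card • chain K (σ.1.erase v)

/-- The grading involution `x ↦ (-1) ^ |x| x`. -/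
def signMap (K : PreAbstractSimplicialComplex V) : Chains K →ₗ[ℤ] Chains K :=
  Finsupp.linearCombination ℤ fun σ : K.faces => (-1 : ℤ) ^ dim σ • Finsupp.single σ (1 : ℤ)

/-- The boundary of the tensor square, `∂ (x ⊗ y) = ∂ x ⊗ y + (-1) ^ |x| x ⊗ ∂ y`. -/
def tensorBoundary (K : PreAbstractSimplicialComplex V) :
    Chains K ⊗[ℤ] Chains K →ₗ[ℤ] Chains K ⊗[ℤ] Chains K :=
  TensorProduct.map (boundary K) LinearMap.id + TensorProduct.map (signMap K) (boundary K)

/-- The symmetry `T (x ⊗ y) = (-1) ^ (|x| |y|) y ⊗ x`. -/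
def swap (K : PreAbstractSimplicialComplex V) :
    Chains K ⊗[ℤ] Chains K →ₗ[ℤ] Chains K ⊗[ℤ] Chains K :=
  TensorProduct.lift <|
    Finsupp.linearCombination ℤ fun σ : K.faces =>
      Finsupp.linearCombination ℤ fun τ : K.faces =>
        (-1 : ℤ) ^ (dim σ * dim τ) •
          ((Finsupp.single τ (1 : ℤ) : Chains K) ⊗ₜ[ℤ] (Finsupp.single σ (1 : ℤ) : Chains K))

/-! ### Consistent sets -/

/-- The intersection of `U` with the packet `{M \ k | k ∈ M}` is a beginning segment or an ending
segment of the packet in the lexicographic order, in which `M \ k'` comes before `M \ k` if and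
only if `k < k'`. -/
def ConsistentAt (U : Set (Finset V)) (M : Finset V) : Prop :=
  (∀ k ∈ M, ∀ k' ∈ M, k < k' → M.erase k ∈ U → M.erase k' ∈ U) ∨
    (∀ k ∈ M, ∀ k' ∈ M, k < k' → M.erase k' ∈ U → M.erase k ∈ U)

/-- `U` is a set of `(i + 1)`-simplices of `K` that is consistent with respect to all
`(i + 2)`-simplices of `K`. -/
def IsConsistent (K : PreAbstractSimplicialComplex V) (i : ℕ) (U : Set (Finset V)) : Prop :=
  (∀ s ∈ U, s ∈ K.faces ∧ s.card = i + 2) ∧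
    ∀ M ∈ K.faces, M.card = i + 3 → ConsistentAt U M

/-! ### The coproduct of a set `U` -/

/-- `U_σ`: the elements of `U` that are `(i + 2)`-element subsets of `σ`. -/
def restrict (i : ℕ) (U : Set (Finset V)) (σ : Finset V) : Set (Finset V) :=
  {s | s ∈ U ∧ s ⊆ σ ∧ s.card = i + 2}

/-- `a` is an even gap in `L`: the number of elements of `L` above `a` is even. -/
def EvenGap (L : Finset V) (a : V) : Prop := Even (L.filter (a < ·)).card

open Classical in
/-- `A_L`: the initial vertex of the cube with generating vectors `L` in the cubillage of the
cyclic zonotope on `σ` with inversion set `U`. -/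
def initVertex (U : Set (Finset V)) (σ L : Finset V) : Finset V :=
  (σ \ L).filter fun a =>
    (insert a L ∈ U ∧ EvenGap L a) ∨ (insert a L ∉ U ∧ ¬ EvenGap L a)

/-- `B_L`: the elements of `σ` that are neither in `L` nor in `A_L`. -/
def coVertex (U : Set (Finset V)) (σ L : Finset V) : Finset V :=
  σ \ (L ∪ initVertex U σ L)

/-- The sign exponent of `(L ∪ A) ⊗ (L ∪ B)` on a simplex with `m` vertices. -/
def signExp (m : ℕ) (L A B : Finset V) : ℕ :=
  ∑ b ∈ B, (A.filter (· < b)).card + ∑ l ∈ L, (L.filter (· < l)).card + m * A.card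

/-- The value on the simplex `σ` of the coproduct with inversion set `U`: the signed sum of
`(L ∪ A_L) ⊗ (L ∪ B_L)` over the `(i + 1)`-element subsets `L` of `σ`. -/
def simplexCoproduct (K : PreAbstractSimplicialComplex V) (i : ℕ) (U : Set (Finset V))
    (σ : Finset V) : Chains K ⊗[ℤ] Chains K :=
  ∑ L ∈ σ.powersetCard (i + 1),
    (-1 : ℤ) ^ signExp σ.card L (initVertex U σ L) (coVertex U σ L) •
      (chain K (L ∪ initVertex U σ L) ⊗ₜ[ℤ] chain K (L ∪ coVertex U σ L))

/-- The simplexwise coproduct `Δ_i^U` on the chains of `K`. -/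
def coproduct (K : PreAbstractSimplicialComplex V) (i : ℕ) (U : Set (Finset V)) :
    Chains K →ₗ[ℤ] Chains K ⊗[ℤ] Chains K :=
  Finsupp.linearCombination ℤ fun σ : K.faces => simplexCoproduct K i (restrict i U σ.1) σ.1

/-- `Δ_{i-1}^∅`, with the convention that it is zero for `i = 0`. -/
def prevCoproduct (K : PreAbstractSimplicialComplex V) :
    ℕ → (Chains K →ₗ[ℤ] Chains K ⊗[ℤ] Chains K)
  | 0 => 0
  | i + 1 => coproduct K i ∅

/-! ### The homotopy formula and the number of terms -/

/-- The homotopy formula `∂ Δ - (-1) ^ i Δ ∂ = (1 + (-1) ^ i T) Δ_{i-1}^∅`. -/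
def HomotopyFormula (K : PreAbstractSimplicialComplex V) (i : ℕ)
    (D : Chains K →ₗ[ℤ] Chains K ⊗[ℤ] Chains K) : Prop :=
  tensorBoundary K ∘ₗ D - (-1 : ℤ) ^ i • (D ∘ₗ boundary K) =
    (LinearMap.id + (-1 : ℤ) ^ i • swap K) ∘ₗ prevCoproduct K i

/-- For `i = 0`, every vertex `σ` is sent to `σ ⊗ σ`; no condition for `i > 0`. -/
def IsNormalized (K : PreAbstractSimplicialComplex V) (i : ℕ)
    (D : Chains K →ₗ[ℤ] Chains K ⊗[ℤ] Chains K) : Prop :=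
  i = 0 → ∀ σ : K.faces, dim σ = 0 →
    D (Finsupp.single σ 1) =
      (Finsupp.single σ (1 : ℤ) : Chains K) ⊗ₜ[ℤ] (Finsupp.single σ (1 : ℤ) : Chains K)

/-- The basis elements `X ⊗ Y` that occur with a non-zero coefficient. -/
def terms {K : PreAbstractSimplicialComplex V} (x : Chains K ⊗[ℤ] Chains K) :
    Finset (K.faces × K.faces) :=
  (finsuppTensorFinsupp' ℤ K.faces K.faces x).support

/-- The number of terms of `D σ`. -/
def numTerms {K : PreAbstractSimplicialComplex V}
    (D : Chains K →ₗ[ℤ] Chains K ⊗[ℤ] Chains K) (σ : K.faces) : ℕ :=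
  (terms (D (Finsupp.single σ 1))).card

/-- The terms of `D σ` involve only faces of `σ`. -/
def IsLocal {K : PreAbstractSimplicialComplex V}
    (D : Chains K →ₗ[ℤ] Chains K ⊗[ℤ] Chains K) : Prop :=
  ∀ σ : K.faces, ∀ p ∈ terms (D (Finsupp.single σ 1)), p.1.1 ⊆ σ.1 ∧ p.2.1 ⊆ σ.1

open Classical in
/-- The total number of terms of `D`, over all simplices. -/
def totalTerms [Fintype V] {K : PreAbstractSimplicialComplex V}
    (D : Chains K →ₗ[ℤ] Chains K ⊗[ℤ] Chains K) : ℕ :=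
  ∑ σ : K.faces, numTerms D σ

end CupCoproduct

end

/-!
A tensor `X ⊗ Y` with `X ∪ Y = σ` encodes a cube in the cyclic zonotope on `σ`: its generating
vectors are `X ∩ Y` and its initial vertex is `X \ Y`. Up to signs, the homotopy formula at the
tensors with `|X ∩ Y| = i` says that the cubes of `Δ(σ)` cancel along interior facets and leave only
the bottom and the top boundary, and at the tensors with `|X ∩ Y| = i + 1` it says that the cubes
for a face of `σ` are the restrictions of those for `σ`.

If `U` is consistent, it orders the elements outside any `L` with `|L| = i`, and the cubes of
`Δ_i^U(σ)` whose generating vectors contain `L` form, in this order, a path from the bottom facet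
to the top facet in direction `L`; the facets between them telescope.

Conversely, a weighted sum over the facets shows that a local solution contains, counted with signs,
one cube for each choice of `i + 1` generating vectors, hence at least `(|σ| choose i + 1)` terms.
In the case of equality there is exactly one such cube, and by restriction its initial vertex is
determined by the simplices with `i + 2` vertices, that is, by a set `U`. For a simplex with `i + 3`
vertices the three cubes containing a given `L` still form a path, and this makes `U` consistent.
A solution with as few terms that is not assumed to be local is compared with its images under the
retractions onto `σ` that send all the vertices outside `σ` to a vertex `w` of `σ`; these images are
local, and two different choices of `w` force the solution itself to be local.
-/

noncomputable section

namespace CupCoproduct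

open scoped TensorProduct

/-! ### Coefficients of chains and tensors -/

section Coefficients

variable {V : Type*} {K : PreAbstractSimplicialComplex V}

open Classical in
/-- The coefficient of a set of vertices in a chain, zero if the set is not a simplex. -/
def chainCoeff (K : PreAbstractSimplicialComplex V) (s : Finset V) : Chains K →ₗ[ℤ] ℤ :=
  if h : s ∈ K.faces then Finsupp.lapply ⟨s, h⟩ else 0

/-- The coefficient of `X ⊗ Y` in a tensor, zero if `X` or `Y` is not a simplex. -/
def tensorCoeff (K : PreAbstractSimplicialComplex V) (X Y : Finset V) :
    Chains K ⊗[ℤ] Chains K →+ ℤ :=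
  (LinearMap.mul' ℤ ℤ ∘ₗ TensorProduct.map (chainCoeff K X) (chainCoeff K Y)).toAddMonoidHom

/-- The coefficient of `X ⊗ Y` in the value of a map to the tensor square on the simplex `τ`, zero
if `τ` is not a simplex. -/
def mapCoeff (D : Chains K →ₗ[ℤ] Chains K ⊗[ℤ] Chains K) (τ X Y : Finset V) : ℤ :=
  tensorCoeff K X Y (D (chain K τ))

theorem nonempty_of_mem_faces {s : Finset V} (hs : s ∈ K.faces) : s.Nonempty :=
  Finset.nonempty_iff_ne_empty.2 fun h => (K.isRelLowerSet_faces.prop_of_mem hs).ne_empty h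

theorem mem_faces_of_subset {s t : Finset V} (ht : t ∈ K.faces) (hst : s ⊆ t) (hs : s.Nonempty) :
    s ∈ K.faces := (K.isRelLowerSet_faces ht).2 hst hs

theorem chain_of_mem {s : Finset V} (hs : s ∈ K.faces) :
    chain K s = Finsupp.single ⟨s, hs⟩ 1 := dif_pos hs

theorem chain_of_notMem {s : Finset V} (hs : s ∉ K.faces) : chain K s = 0 := dif_neg hs

theorem chain_empty : chain K ∅ = 0 :=
  chain_of_notMem fun h => Finset.not_nonempty_empty (nonempty_of_mem_faces h)

theorem chain_coe (σ : K.faces) : chain K σ.1 = Finsupp.single σ 1 := chain_of_mem σ.2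

theorem chainCoeff_of_mem {s : Finset V} (hs : s ∈ K.faces) (a : Chains K) :
    chainCoeff K s a = a ⟨s, hs⟩ := by
  simp [chainCoeff, hs]

theorem chainCoeff_of_notMem {s : Finset V} (hs : s ∉ K.faces) : chainCoeff K s = 0 :=
  dif_neg hs

theorem chainCoeff_chain [DecidableEq V] {s t : Finset V} (ht : t ∈ K.faces) :
    chainCoeff K s (chain K t) = if s = t then 1 else 0 := by
  by_cases hs : s ∈ K.faces
  · rw [chainCoeff_of_mem hs, chain_of_mem ht, Finsupp.single_apply]
    simp only [Subtype.mk.injEq, eq_comm]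
  · rw [chainCoeff_of_notMem hs, if_neg (by grind), LinearMap.zero_apply]

theorem chains_ext {a b : Chains K} (h : ∀ s ∈ K.faces, chainCoeff K s a = chainCoeff K s b) :
    a = b := by
  ext σ
  simpa only [chainCoeff_of_mem σ.2] using h σ.1 σ.2

theorem tensorCoeff_tmul (X Y : Finset V) (a b : Chains K) :
    tensorCoeff K X Y (a ⊗ₜ[ℤ] b) = chainCoeff K X a * chainCoeff K Y b := rfl

theorem tensorCoeff_tmul_chain [DecidableEq V] {X Y s t : Finset V} (hs : s ∈ K.faces)
    (ht : t ∈ K.faces) :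
    tensorCoeff K X Y (chain K s ⊗ₜ[ℤ] chain K t) = if X = s ∧ Y = t then 1 else 0 := by
  rw [tensorCoeff_tmul, chainCoeff_chain hs, chainCoeff_chain ht, ite_zero_mul_ite_zero, mul_one]

theorem addMonoidHom_ext {M : Type*} [AddCommGroup M] {f g : Chains K →+ M}
    (h : ∀ s ∈ K.faces, f (chain K s) = g (chain K s)) : f = g := by
  ext σ
  simpa [chain_coe] using h σ.1 σ.2

theorem linearMap_ext {M : Type*} [AddCommGroup M] {f g : Chains K →ₗ[ℤ] M}
    (h : ∀ s ∈ K.faces, f (chain K s) = g (chain K s)) : f = g :=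
  LinearMap.toAddMonoidHom_injective (addMonoidHom_ext h)

theorem tensor_addMonoidHom_ext {M : Type*} [AddCommGroup M]
    {f g : Chains K ⊗[ℤ] Chains K →+ M}
    (h : ∀ s ∈ K.faces, ∀ t ∈ K.faces,
      f (chain K s ⊗ₜ[ℤ] chain K t) = g (chain K s ⊗ₜ[ℤ] chain K t)) : f = g := by
  have hright : ∀ s ∈ K.faces, ∀ b, f (chain K s ⊗ₜ[ℤ] b) = g (chain K s ⊗ₜ[ℤ] b) := fun s hs =>
    DFunLike.congr_fun <| addMonoidHom_ext
      (f := f.comp (TensorProduct.mk ℤ (Chains K) (Chains K) (chain K s)).toAddMonoidHom)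
      (g := g.comp (TensorProduct.mk ℤ (Chains K) (Chains K) (chain K s)).toAddMonoidHom) (h s hs)
  have htmul : ∀ b a, f (a ⊗ₜ[ℤ] b) = g (a ⊗ₜ[ℤ] b) := fun b =>
    DFunLike.congr_fun <| addMonoidHom_ext
      (f := f.comp ((TensorProduct.mk ℤ (Chains K) (Chains K)).flip b).toAddMonoidHom)
      (g := g.comp ((TensorProduct.mk ℤ (Chains K) (Chains K)).flip b).toAddMonoidHom)
      fun s hs => hright s hs b
  ext z
  induction z using TensorProduct.induction_on with
  | zero => rw [map_zero, map_zero]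
  | tmul a b => exact htmul b a
  | add z z' hz hz' => rw [map_add, map_add, hz, hz']

theorem tensorCoeff_coe (X Y : K.faces) (z : Chains K ⊗[ℤ] Chains K) :
    tensorCoeff K X.1 Y.1 z = finsuppTensorFinsupp' ℤ K.faces K.faces z (X, Y) := by
  suffices h : tensorCoeff K X.1 Y.1 = (Finsupp.applyAddHom (X, Y)).comp
      (finsuppTensorFinsupp' ℤ K.faces K.faces).toLinearMap.toAddMonoidHom from
    DFunLike.congr_fun h z
  refine tensor_addMonoidHom_ext fun s _ t _ => ?_
  rw [tensorCoeff_tmul, chainCoeff_of_mem X.2, chainCoeff_of_mem Y.2]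
  exact (finsuppTensorFinsupp'_apply_apply ℤ _ _ _ _ _ _).symm

theorem tensorCoeff_of_notMem {X Y : Finset V} (h : ¬ (X ∈ K.faces ∧ Y ∈ K.faces)) :
    tensorCoeff K X Y = 0 := by
  refine tensor_addMonoidHom_ext fun s _ t _ => ?_
  rw [tensorCoeff_tmul, AddMonoidHom.zero_apply, mul_eq_zero]
  exact (not_and_or.1 h).imp
    (fun hX => by rw [chainCoeff_of_notMem hX, LinearMap.zero_apply])
    fun hY => by rw [chainCoeff_of_notMem hY, LinearMap.zero_apply]

theorem tensor_ext {z z' : Chains K ⊗[ℤ] Chains K}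
    (h : ∀ X ∈ K.faces, ∀ Y ∈ K.faces, tensorCoeff K X Y z = tensorCoeff K X Y z') : z = z' := by
  apply (finsuppTensorFinsupp' ℤ K.faces K.faces).injective
  ext ⟨X, Y⟩
  simpa only [tensorCoeff_coe] using h X.1 X.2 Y.1 Y.2

theorem mem_terms {z : Chains K ⊗[ℤ] Chains K} {p : K.faces × K.faces} :
    p ∈ terms z ↔ tensorCoeff K p.1.1 p.2.1 z ≠ 0 := by
  rw [tensorCoeff_coe, terms, Finsupp.mem_support_iff]

theorem tensor_eq_sum_terms (z : Chains K ⊗[ℤ] Chains K) :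
    z = ∑ p ∈ terms z, tensorCoeff K p.1.1 p.2.1 z • (chain K p.1.1 ⊗ₜ[ℤ] chain K p.2.1) := by
  classical
  refine tensor_ext fun X hX Y hY => ?_
  have hterm : ∀ p ∈ terms z, tensorCoeff K X Y
      (tensorCoeff K p.1.1 p.2.1 z • (chain K p.1.1 ⊗ₜ[ℤ] chain K p.2.1)) =
      if p = (⟨X, hX⟩, ⟨Y, hY⟩) then tensorCoeff K X Y z else 0 := by
    rintro ⟨⟨s, hs⟩, t, ht⟩ -
    rw [map_zsmul, tensorCoeff_tmul_chain hs ht, smul_eq_mul, mul_ite, mul_one, mul_zero]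
    split_ifs <;> simp_all
  rw [map_sum, Finset.sum_congr rfl hterm, Finset.sum_ite_eq', eq_comm, ite_eq_left_iff, mem_terms,
    not_not]
  exact Eq.symm

theorem mapCoeff_ext {D D' : Chains K →ₗ[ℤ] Chains K ⊗[ℤ] Chains K}
    (h : ∀ τ ∈ K.faces, ∀ X ∈ K.faces, ∀ Y ∈ K.faces, mapCoeff D τ X Y = mapCoeff D' τ X Y) :
    D = D' :=
  linearMap_ext fun τ hτ => tensor_ext fun X hX Y hY => h τ hτ X hX Y hY

theorem mem_faces_of_mapCoeff_ne_zero {D : Chains K →ₗ[ℤ] Chains K ⊗[ℤ] Chains K}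
    {τ X Y : Finset V} (h : mapCoeff D τ X Y ≠ 0) : τ ∈ K.faces ∧ X ∈ K.faces ∧ Y ∈ K.faces := by
  constructor <;> by_contra h'
  · exact h (by rw [mapCoeff, chain_of_notMem h', map_zero, map_zero])
  · exact h (by rw [mapCoeff, tensorCoeff_of_notMem h', AddMonoidHom.zero_apply])

/-- The value on `τ` only involves faces of `τ`. -/
def IsLocalAt (D : Chains K →ₗ[ℤ] Chains K ⊗[ℤ] Chains K) (τ : Finset V) : Prop :=
  ∀ X Y, mapCoeff D τ X Y ≠ 0 → X ⊆ τ ∧ Y ⊆ τ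

theorem isLocalAt_iff {D : Chains K →ₗ[ℤ] Chains K ⊗[ℤ] Chains K} {τ : Finset V} :
    IsLocalAt D τ ↔ ∀ p ∈ terms (D (chain K τ)), p.1.1 ⊆ τ ∧ p.2.1 ⊆ τ :=
  ⟨fun h _ hp => h _ _ (mem_terms.1 hp), fun h X Y hne =>
    have hface := (mem_faces_of_mapCoeff_ne_zero hne).2
    h (⟨X, hface.1⟩, ⟨Y, hface.2⟩) (mem_terms.2 hne)⟩

theorem isLocal_iff {D : Chains K →ₗ[ℤ] Chains K ⊗[ℤ] Chains K} :
    IsLocal D ↔ ∀ σ, IsLocalAt D σ := by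
  refine ⟨fun h σ X Y hne => ?_, fun h σ => ?_⟩
  · obtain ⟨hσ, -, -⟩ := mem_faces_of_mapCoeff_ne_zero hne
    have hσ' := h ⟨σ, hσ⟩
    rw [← chain_coe] at hσ'
    exact isLocalAt_iff.2 hσ' X Y hne
  · rw [← chain_coe]
    exact isLocalAt_iff.1 (h σ.1)

theorem numTerms_eq (D : Chains K →ₗ[ℤ] Chains K ⊗[ℤ] Chains K) (σ : K.faces) :
    numTerms D σ = (terms (D (chain K σ.1))).card := by
  rw [chain_coe, numTerms]

theorem IsNormalized.apply_chain {D : Chains K →ₗ[ℤ] Chains K ⊗[ℤ] Chains K} {i : ℕ}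
    (h : IsNormalized K i D) (hi : i = 0) (v : V) :
    D (chain K {v}) = chain K {v} ⊗ₜ[ℤ] chain K {v} := by
  by_cases hv : {v} ∈ K.faces
  · rw [chain_of_mem hv]
    exact h hi ⟨{v}, hv⟩ (by simp [dim])
  · rw [chain_of_notMem hv, map_zero, TensorProduct.zero_tmul]

theorem card_terms_chain_le {D : Chains K →ₗ[ℤ] Chains K ⊗[ℤ] Chains K} {b : ℕ → ℕ}
    (h : ∀ σ : K.faces, numTerms D σ ≤ b σ.1.card) (σ : Finset V) :
    (terms (D (chain K σ))).card ≤ b σ.card := by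
  by_cases hσ : σ ∈ K.faces
  · exact (numTerms_eq D ⟨σ, hσ⟩).symm.trans_le (h ⟨σ, hσ⟩)
  · simp [chain_of_notMem hσ, terms]

theorem numTerms_le_of_totalTerms_le [Fintype V]
    {D D' : Chains K →ₗ[ℤ] Chains K ⊗[ℤ] Chains K}
    (hle : ∀ σ, numTerms D' σ ≤ numTerms D σ) (htotal : totalTerms D ≤ totalTerms D')
    (σ : K.faces) : numTerms D σ ≤ numTerms D' σ := by
  classical
  exact ((Finset.sum_eq_sum_iff_of_le fun τ _ => hle τ).1
    ((Finset.sum_le_sum fun τ _ => hle τ).antisymm htotal) σ (Finset.mem_univ σ)).ge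

/-- The augmentation: the sum of the coefficients of the vertices. -/
def augmentation (K : PreAbstractSimplicialComplex V) : Chains K →ₗ[ℤ] ℤ :=
  Finsupp.linearCombination ℤ fun τ : K.faces => if τ.1.card = 1 then (1 : ℤ) else 0

theorem augmentation_chain {s : Finset V} (hs : s ∈ K.faces) :
    augmentation K (chain K s) = if s.card = 1 then 1 else 0 := by
  rw [chain_of_mem hs, augmentation, Finsupp.linearCombination_single, one_smul]

theorem signMap_chain (s : Finset V) :
    signMap K (chain K s) = (-1 : ℤ) ^ (s.card - 1) • chain K s := by
  by_cases hs : s ∈ K.faces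
  · rw [chain_of_mem hs, signMap, Finsupp.linearCombination_single, one_smul]
    rfl
  · rw [chain_of_notMem hs, map_zero, smul_zero]

theorem chainCoeff_signMap (s : Finset V) (a : Chains K) :
    chainCoeff K s (signMap K a) = (-1) ^ (s.card - 1) * chainCoeff K s a := by
  classical
  suffices h : chainCoeff K s ∘ₗ signMap K = (-1 : ℤ) ^ (s.card - 1) • chainCoeff K s from
    LinearMap.congr_fun h a
  refine linearMap_ext fun t ht => ?_
  rw [LinearMap.comp_apply, signMap_chain, map_smul, LinearMap.smul_apply, chainCoeff_chain ht]
  split_ifs with h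
  · rw [h]
  · rw [smul_zero, smul_zero]

theorem swap_tmul_chain {s t : Finset V} (hs : s ∈ K.faces) (ht : t ∈ K.faces) :
    swap K (chain K s ⊗ₜ[ℤ] chain K t) =
      (-1 : ℤ) ^ ((s.card - 1) * (t.card - 1)) • (chain K t ⊗ₜ[ℤ] chain K s) := by
  rw [chain_of_mem hs, chain_of_mem ht]
  refine (TensorProduct.lift.tmul _ _).trans ?_
  rw [Finsupp.linearCombination_single, one_smul, Finsupp.linearCombination_single, one_smul]
  rfl

theorem tensorCoeff_swap (X Y : Finset V) (z : Chains K ⊗[ℤ] Chains K) :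
    tensorCoeff K X Y (swap K z) =
      (-1) ^ ((X.card - 1) * (Y.card - 1)) * tensorCoeff K Y X z := by
  classical
  suffices h : (tensorCoeff K X Y).comp (swap K).toAddMonoidHom =
      (-1 : ℤ) ^ ((X.card - 1) * (Y.card - 1)) • tensorCoeff K Y X from DFunLike.congr_fun h z
  refine tensor_addMonoidHom_ext fun s hs t ht => ?_
  rw [AddMonoidHom.comp_apply, LinearMap.toAddMonoidHom_coe, swap_tmul_chain hs ht, map_zsmul,
    AddMonoidHom.smul_apply, tensorCoeff_tmul_chain ht hs, tensorCoeff_tmul_chain hs ht]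
  by_cases hX : X = t <;> by_cases hY : Y = s <;> simp [hX, hY, mul_comm]

end Coefficients

variable {V : Type*} [LinearOrder V]

/-! ### Counting and signs -/

/-- The number of elements of `s` below `x`. -/
def below (s : Finset V) (x : V) : ℕ := (s.filter (· < x)).card

/-- The number of elements of `s` above `x`; its parity decides whether `x` is an even gap. -/
def above (s : Finset V) (x : V) : ℕ := (s.filter (x < ·)).card

/-- The number of pairs `a < b` with `a ∈ A` and `b ∈ B`. -/
def ascents (A B : Finset V) : ℕ := ∑ b ∈ B, below A b

theorem evenGap_iff {L : Finset V} {a : V} : EvenGap L a ↔ Even (above L a) := Iff.rfl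

theorem signExp_eq (m : ℕ) (L A B : Finset V) :
    signExp m L A B = ascents A B + ascents L L + m * A.card := rfl

theorem below_add_above {s : Finset V} {x : V} (hx : x ∉ s) :
    below s x + above s x = s.card := by
  rw [below, above, ← Finset.card_filter_add_card_filter_not (s := s) (· < x)]
  congr 2
  exact Finset.filter_congr fun y hy =>
    ⟨fun h => h.not_gt, fun h => lt_of_le_of_ne (not_lt.1 h) (ne_of_mem_of_not_mem hy hx).symm⟩

theorem below_union {s t : Finset V} (h : Disjoint s t) (x : V) :
    below (s ∪ t) x = below s x + below t x := by
  rw [below, Finset.filter_union,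
    Finset.card_union_of_disjoint (Finset.disjoint_filter_filter h)]
  rfl

theorem below_insert_self (s : Finset V) (x : V) : below (insert x s) x = below s x := by
  simp [below, Finset.filter_insert]

theorem below_erase_self (s : Finset V) (x : V) : below (s.erase x) x = below s x := by
  simp [below, Finset.filter_erase]

theorem below_insert {s : Finset V} {x : V} (hx : x ∉ s) (y : V) :
    below (insert x s) y = below s y + if x < y then 1 else 0 := by
  rw [below, Finset.filter_insert, below]
  split_ifs
  · exact Finset.card_insert_of_notMem (by simp [hx])
  · rfl

theorem above_insert {s : Finset V} {x : V} (hx : x ∉ s) (y : V) :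
    above (insert x s) y = above s y + if y < x then 1 else 0 := by
  rw [above, Finset.filter_insert, above]
  split_ifs
  · exact Finset.card_insert_of_notMem (by simp [hx])
  · rfl

theorem evenGap_insert {L : Finset V} {x y : V} (hx : x ∉ L) :
    EvenGap (insert x L) y ↔ (EvenGap L y ↔ ¬ y < x) := by
  rw [evenGap_iff, evenGap_iff, above_insert hx, Nat.even_add]
  by_cases h : y < x <;> simp [h]

theorem ascents_eq_sum_above (A B : Finset V) : ascents A B = ∑ a ∈ A, above B a := by
  simp only [ascents, below, above, Finset.card_filter]
  exact Finset.sum_comm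

theorem ascents_insert_right {A B : Finset V} {x : V} (hx : x ∉ B) :
    ascents A (insert x B) = ascents A B + below A x := by
  rw [ascents, Finset.sum_insert hx, add_comm, ascents]

theorem ascents_insert_left {A B : Finset V} {x : V} (hx : x ∉ A) :
    ascents (insert x A) B = ascents A B + above B x := by
  rw [ascents_eq_sum_above, Finset.sum_insert hx, add_comm, ascents_eq_sum_above]

theorem ascents_insert_insert {L : Finset V} {x : V} (hx : x ∉ L) :
    ascents (insert x L) (insert x L) = ascents L L + L.card := by
  rw [ascents_insert_right hx, ascents_insert_left hx, below_insert_self, ← below_add_above hx]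
  ring

theorem ascents_add_ascents {A B : Finset V} (h : Disjoint A B) :
    ascents A B + ascents B A = A.card * B.card := by
  rw [ascents, ascents_eq_sum_above B A, ← Finset.sum_add_distrib,
    Finset.sum_congr rfl fun b hb => below_add_above (Finset.disjoint_right.1 h hb),
    Finset.sum_const, smul_eq_mul, mul_comm]

theorem neg_one_pow_mul_self (n : ℕ) : (-1 : ℤ) ^ n * (-1) ^ n = 1 := by
  rw [← mul_pow, neg_one_mul, neg_neg, one_pow]

theorem neg_one_pow_mul_cancel (n : ℕ) (a : ℤ) : (-1) ^ n * ((-1) ^ n * a) = a := by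
  rw [← mul_assoc, neg_one_pow_mul_self, one_mul]

/-- Three pairwise disjoint sets, encoding the cube with generating vectors `L` and initial vertex
`A` in the zonotope on `L ∪ A ∪ B`. It corresponds to the tensor `(L ∪ A) ⊗ (L ∪ B)`. -/
structure IsCube {α : Type*} (L A B : Finset α) : Prop where
  disjoint_left : Disjoint L A
  disjoint_right : Disjoint L B
  disjoint : Disjoint A B

namespace IsCube

variable {α : Type*} {L A B : Finset α}

theorem symm (h : IsCube L A B) : IsCube L B A :=
  ⟨h.disjoint_right, h.disjoint_left, h.disjoint.symm⟩

variable [DecidableEq α]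

theorem of_inter (X Y : Finset α) : IsCube (X ∩ Y) (X \ Y) (Y \ X) := by
  constructor <;> exact Finset.disjoint_left.2 (by grind)

theorem of_subset {σ : Finset α} (hA : A ⊆ σ \ L) : IsCube L A (σ \ (L ∪ A)) := by
  constructor <;> exact Finset.disjoint_left.2 (by grind)

theorem card_union (h : IsCube L A B) : (L ∪ A).card = L.card + A.card :=
  Finset.card_union_of_disjoint h.disjoint_left

theorem disjoint_union (h : IsCube L A B) : Disjoint (L ∪ A) B :=
  Finset.disjoint_union_left.2 ⟨h.disjoint_right, h.disjoint⟩

theorem card_union_union (h : IsCube L A B) :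
    (L ∪ A ∪ B).card = L.card + A.card + B.card := by
  rw [Finset.card_union_of_disjoint h.disjoint_union, h.card_union]

theorem union_inter_union (h : IsCube L A B) : (L ∪ A) ∩ (L ∪ B) = L := by
  rw [← Finset.union_inter_distrib_left, Finset.disjoint_iff_inter_eq_empty.1 h.disjoint,
    Finset.union_empty]

theorem union_sdiff_union (h : IsCube L A B) : (L ∪ A) \ (L ∪ B) = A := by
  have := Finset.disjoint_left.1 h.disjoint_left
  have := Finset.disjoint_left.1 h.disjoint
  grind

theorem union_union_sdiff_union (h : IsCube L A B) : (L ∪ A ∪ B) \ (L ∪ A) = B :=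
  Finset.union_sdiff_cancel_left h.disjoint_union

theorem union_union_sdiff (h : IsCube L A B) : (L ∪ A ∪ B) \ A = L ∪ B := by
  rw [Finset.union_right_comm]
  exact Finset.union_sdiff_cancel_right
    (Finset.disjoint_union_left.2 ⟨h.disjoint_left, h.disjoint.symm⟩)

theorem insert_left (h : IsCube L A B) {x : α} (hx : x ∉ L ∪ B) : IsCube L (insert x A) B := by
  rw [Finset.notMem_union] at hx
  exact ⟨Finset.disjoint_insert_right.2 ⟨hx.1, h.disjoint_left⟩, h.disjoint_right,
    Finset.disjoint_insert_left.2 ⟨hx.2, h.disjoint⟩⟩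

end IsCube

section Signs

variable {L A B : Finset V} {x : V} {m : ℕ}

theorem sign_remove_left (hLA : Disjoint L A) (hxL : x ∉ L) (hxB : x ∉ B) :
    (-1 : ℤ) ^ below (L ∪ A) x * (-1) ^ signExp m (insert x L) A B =
      (-1) ^ signExp m L A (insert x B) * (-1) ^ above L x := by
  rw [← pow_add, ← pow_add]
  refine neg_one_pow_congr ?_
  rw [signExp_eq, signExp_eq, below_union hLA, ascents_insert_insert hxL,
    ascents_insert_right hxB, ← below_add_above hxL]
  simp only [Nat.even_iff]
  omega

theorem sign_remove_right (hLB : Disjoint L B) (hxL : x ∉ L) (hxA : x ∉ A) (hxB : x ∉ B)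
    (hm : m = L.card + A.card + B.card + 1) :
    (-1 : ℤ) ^ (L.card + A.card) * (-1 : ℤ) ^ below (L ∪ B) x *
        (-1) ^ signExp m (insert x L) A B =
      (-1) ^ signExp m L (insert x A) B * (-1) ^ (above L x + 1) := by
  rw [← pow_add, ← pow_add, ← pow_add]
  refine neg_one_pow_congr ?_
  rw [signExp_eq, signExp_eq, below_union hLB, ascents_insert_insert hxL,
    ascents_insert_left hxA, Finset.card_insert_of_notMem hxA, mul_add_one]
  have hL := below_add_above hxL
  have hB := below_add_above hxB
  simp only [Nat.even_iff]
  omega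

theorem sign_swap {i : ℕ} (hAB : Disjoint A B) (hm : m = i + A.card + B.card)
    (hA : 0 < i + A.card) (hB : 0 < i + B.card) :
    (-1 : ℤ) ^ i * ((-1) ^ ((i + A.card - 1) * (i + B.card - 1)) * (-1) ^ signExp m L B A) =
      -(-1) ^ signExp m L A B := by
  obtain ⟨a, ha⟩ := Nat.exists_eq_add_of_lt hA
  obtain ⟨b, hb⟩ := Nat.exists_eq_add_of_lt hB
  rw [show (-(-1) ^ signExp m L A B : ℤ) = (-1) ^ (signExp m L A B + 1) by ring,
    ← pow_add, ← pow_add]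
  refine neg_one_pow_congr ?_
  rw [signExp_eq, signExp_eq, show i + A.card - 1 = a by omega, show i + B.card - 1 = b by omega]
  have hasc := congrArg Even (ascents_add_ascents hAB)
  have hA' := congrArg Even ha
  have hB' := congrArg Even hb
  subst hm
  simp only [Nat.even_add, Nat.even_mul, Nat.even_add_one, zero_add, eq_iff_iff]
    at hasc hA' hB' ⊢
  grind

theorem sign_extend_left (h : IsCube L A B) (hxA : x ∉ A) (hxB : x ∉ B) (hL : 0 < L.card)
    (hm : m = L.card + A.card + B.card) :
    (-1 : ℤ) ^ below (L ∪ A) x * (-1) ^ signExp (m + 1) L (insert x A) B =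
      (-1) ^ (L.card - 1) * ((-1) ^ below (L ∪ A ∪ B) x * (-1) ^ signExp m L A B) := by
  rw [← pow_add, ← pow_add, ← pow_add]
  refine neg_one_pow_congr ?_
  rw [signExp_eq, signExp_eq, below_union h.disjoint_union, below_union h.disjoint_left,
    ascents_insert_left hxA, Finset.card_insert_of_notMem hxA]
  have hB := below_add_above hxB
  simp only [Nat.even_iff, mul_add, add_mul, one_mul, mul_one]
  omega

theorem sign_extend_right (h : IsCube L A B) (hxB : x ∉ B) (hL : 0 < L.card) :
    (-1 : ℤ) ^ ((L ∪ A).card - 1) *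
        ((-1 : ℤ) ^ below (L ∪ B) x * (-1) ^ signExp (m + 1) L A (insert x B)) =
      (-1) ^ (L.card - 1) * ((-1) ^ below (L ∪ A ∪ B) x * (-1) ^ signExp m L A B) := by
  rw [← pow_add, ← pow_add, ← pow_add, ← pow_add]
  refine neg_one_pow_congr ?_
  rw [signExp_eq, signExp_eq, below_union h.disjoint_union, below_union h.disjoint_left,
    below_union h.disjoint_right, ascents_insert_right hxB, h.card_union, add_one_mul m]
  simp only [Nat.even_iff]
  omega

end Signs

/-! ### The homotopy formula in coefficients -/

open Classical in
/-- The coefficient of `X ⊗ Y` in the value on `τ` of the coproduct with inversion set `U` whose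
generating sets have `k` elements. -/
def coproductCoeff (k : ℕ) (U : Set (Finset V)) (τ X Y : Finset V) : ℤ :=
  if X ∪ Y = τ ∧ (X ∩ Y).card = k ∧ X \ Y = initVertex U τ (X ∩ Y) then
    (-1) ^ signExp τ.card (X ∩ Y) (X \ Y) (Y \ X) else 0

/-- The homotopy formula on the simplex `τ` at the coefficient of `X ⊗ Y`, where `c τ X Y` is the
coefficient of `X ⊗ Y` in the value on `τ` of a local map. -/
def CoeffHomotopyFormula (c : Finset V → Finset V → Finset V → ℤ) (i : ℕ)
    (τ X Y : Finset V) : Prop :=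
  ∑ x ∈ τ \ X, (-1) ^ below X x * c τ (insert x X) Y +
      (-1) ^ (X.card - 1) * ∑ y ∈ τ \ Y, (-1) ^ below Y y * c τ X (insert y Y) -
      (-1) ^ i * ∑ w ∈ τ, (-1) ^ below τ w * c (τ.erase w) X Y =
    coproductCoeff i ∅ τ X Y +
      (-1) ^ i * ((-1) ^ ((X.card - 1) * (Y.card - 1)) * coproductCoeff i ∅ τ Y X)

/-- The coefficient of the cube in the zonotope on `σ` with generating vectors `L` and initial
vertex `A`, corrected by the sign it has in a coproduct. -/
def cubeCoeff (c : Finset V → Finset V → Finset V → ℤ) (σ L A : Finset V) : ℤ :=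
  (-1) ^ signExp σ.card L A (σ \ (L ∪ A)) * c σ (L ∪ A) (σ \ A)

open Classical in
/-- The sign with which the facet with generating vectors `L` and initial vertex `A` occurs in the
boundary of the cube that extends it in direction `x`: in direction `x` this cube ends at the facet
if `x ∈ A`, and starts at it otherwise. -/
def facetSign (L A : Finset V) (x : V) : ℤ := if x ∈ A ↔ EvenGap L x then -1 else 1

/-- The homotopy formula for the cubes in the zonotope on `σ`: up to sign, the cubes that contain
the facet with generating vectors `L` and initial vertex `A` cancel, unless the facet belongs to the
bottom or to the top of the zonotope. -/
def CubicalFormula (c : Finset V → Finset V → Finset V → ℤ) (σ L A : Finset V) : Prop :=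
  ∑ x ∈ σ \ L, facetSign L A x * cubeCoeff c σ (insert x L) (A.erase x) =
    (if A = initVertex ∅ σ L then 1 else 0) - if σ \ (L ∪ A) = initVertex ∅ σ L then 1 else 0

theorem facetSign_of_notMem {L A : Finset V} {x : V} (hx : x ∉ A) :
    facetSign L A x = (-1) ^ above L x := by
  rw [facetSign, evenGap_iff]
  by_cases h : Even (above L x) <;> simp [neg_one_pow_eq_ite, h, hx]

theorem facetSign_of_mem {L A : Finset V} {x : V} (hx : x ∈ A) :
    facetSign L A x = (-1) ^ (above L x + 1) := by
  rw [facetSign, evenGap_iff]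
  by_cases h : Even (above L x) <;> simp [pow_succ, neg_one_pow_eq_ite, h, hx]

theorem eq_of_coproductCoeff_ne_zero {k : ℕ} {U : Set (Finset V)} {τ X Y : Finset V}
    (h : coproductCoeff k U τ X Y ≠ 0) :
    X ∪ Y = τ ∧ (X ∩ Y).card = k ∧ X \ Y = initVertex U τ (X ∩ Y) := by
  by_contra h'
  exact h (if_neg h')

theorem subset_of_coproductCoeff_ne_zero {k : ℕ} {U : Set (Finset V)} {τ X Y : Finset V}
    (h : coproductCoeff k U τ X Y ≠ 0) : X ⊆ τ ∧ Y ⊆ τ := by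
  rw [← (eq_of_coproductCoeff_ne_zero h).1]
  exact ⟨Finset.subset_union_left, Finset.subset_union_right⟩

open Classical in
theorem coproductCoeff_union_union {k : ℕ} {U : Set (Finset V)} {τ L A B : Finset V}
    (h : IsCube L A B) :
    coproductCoeff k U τ (L ∪ A) (L ∪ B) =
      if L ∪ A ∪ B = τ ∧ L.card = k ∧ A = initVertex U τ L then
        (-1) ^ signExp τ.card L A B else 0 := by
  rw [coproductCoeff, h.union_inter_union, h.union_sdiff_union, h.symm.union_sdiff_union,
    ← Finset.union_union_distrib_left, ← Finset.union_assoc]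

section Facet

variable {c : Finset V → Finset V → Finset V → ℤ} {σ L A B : Finset V}

theorem first_summand_eq (h : IsCube L A B) (hσ : L ∪ A ∪ B = σ) {x : V} (hx : x ∈ B) :
    (-1) ^ below (L ∪ A) x * c σ (insert x (L ∪ A)) (L ∪ B) =
      (-1) ^ signExp σ.card L A B *
        (facetSign L A x * cubeCoeff c σ (insert x L) (A.erase x)) := by
  have hxL : x ∉ L := Finset.disjoint_right.1 h.disjoint_right hx
  have hxA : x ∉ A := Finset.disjoint_right.1 h.disjoint hx
  have hsign := sign_remove_left (m := σ.card) h.disjoint_left hxL (Finset.notMem_erase x B)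
  rw [Finset.insert_erase hx] at hsign
  have hB : σ \ (insert x L ∪ A) = B.erase x := by
    rw [Finset.insert_union, Finset.sdiff_insert, ← hσ, h.union_union_sdiff_union]
  rw [facetSign_of_notMem hxA, Finset.erase_eq_of_notMem hxA, cubeCoeff, hB, Finset.insert_union,
    ← hσ, h.union_union_sdiff, hσ, ← mul_assoc, ← hsign,
    mul_assoc _ ((-1 : ℤ) ^ signExp _ _ _ _), neg_one_pow_mul_cancel]

theorem second_summand_eq (h : IsCube L A B) (hσ : L ∪ A ∪ B = σ) {x : V} (hx : x ∈ A) :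
    (-1) ^ ((L ∪ A).card - 1) * ((-1) ^ below (L ∪ B) x * c σ (L ∪ A) (insert x (L ∪ B))) =
      (-1) ^ signExp σ.card L A B *
        (facetSign L A x * cubeCoeff c σ (insert x L) (A.erase x)) := by
  have hxL : x ∉ L := Finset.disjoint_right.1 h.disjoint_left hx
  have hxB : x ∉ B := Finset.disjoint_left.1 h.disjoint hx
  have hcard : A.card = (A.erase x).card + 1 := (Finset.card_erase_add_one hx).symm
  have hm : σ.card = L.card + (A.erase x).card + B.card + 1 := by
    rw [← hσ, h.card_union_union]
    omega
  have hsign := sign_remove_right h.disjoint_right hxL (Finset.notMem_erase x A) hxB hm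
  rw [Finset.insert_erase hx] at hsign
  have hA : insert x L ∪ A.erase x = L ∪ A := by grind
  have hB : σ \ A.erase x = insert x (L ∪ B) := by
    rw [← h.union_union_sdiff, hσ, Finset.sdiff_erase]
    exact hσ ▸ Finset.mem_union_left _ (Finset.mem_union_right _ hx)
  rw [facetSign_of_mem hx, cubeCoeff, hA, hB, ← hσ, h.union_union_sdiff_union, hσ, ← mul_assoc,
    ← mul_assoc, ← hsign, h.card_union, hcard, ← add_assoc, Nat.add_sub_cancel,
    mul_assoc _ ((-1 : ℤ) ^ signExp _ _ _ _), neg_one_pow_mul_cancel]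

theorem coeffHomotopyFormula_iff_cubicalFormula {i : ℕ} (h : IsCube L A B) (hσ : L ∪ A ∪ B = σ)
    (hL : L.card = i) (hA : (L ∪ A).Nonempty) (hB : (L ∪ B).Nonempty)
    (hc : ∀ w ∈ σ, c (σ.erase w) (L ∪ A) (L ∪ B) = 0) :
    CoeffHomotopyFormula c i σ (L ∪ A) (L ∪ B) ↔ CubicalFormula c σ L A := by
  set e : ℤ := (-1) ^ signExp σ.card L A B with he
  have hσA : σ \ (L ∪ A) = B := by rw [← hσ, h.union_union_sdiff_union]
  have hσB : σ \ (L ∪ B) = A := by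
    rw [← hσ, Finset.union_right_comm, h.symm.union_union_sdiff_union]
  have hσL : σ \ L = B ∪ A := by
    rw [← hσ, Finset.union_assoc, Finset.union_sdiff_cancel_left, Finset.union_comm]
    exact Finset.disjoint_union_right.2 ⟨h.disjoint_left, h.disjoint_right⟩
  have hfaces : ∑ w ∈ σ, (-1) ^ below σ w * c (σ.erase w) (L ∪ A) (L ∪ B) = 0 :=
    Finset.sum_eq_zero fun w hw => by rw [hc w hw, mul_zero]
  have hbottom : coproductCoeff i ∅ σ (L ∪ A) (L ∪ B) =
      e * if A = initVertex ∅ σ L then 1 else 0 := by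
    rw [coproductCoeff_union_union h, mul_ite, mul_one, mul_zero]
    simp only [hσ, hL, true_and, he]
  have htop : (-1) ^ i * ((-1) ^ (((L ∪ A).card - 1) * ((L ∪ B).card - 1)) *
      coproductCoeff i ∅ σ (L ∪ B) (L ∪ A)) = -(e * if B = initVertex ∅ σ L then 1 else 0) := by
    have hm : σ.card = i + A.card + B.card := by rw [← hσ, h.card_union_union, hL]
    have hAcard := Finset.card_pos.2 hA
    have hBcard := Finset.card_pos.2 hB
    rw [h.card_union, hL] at hAcard
    rw [h.symm.card_union, hL] at hBcard
    rw [coproductCoeff_union_union h.symm, Finset.union_right_comm, h.card_union,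
      h.symm.card_union, hL]
    simp only [hσ, true_and]
    split_ifs
    · rw [sign_swap h.disjoint hm hAcard hBcard, mul_one]
    · simp
  rw [CoeffHomotopyFormula, CubicalFormula, hfaces, hbottom, htop, hσA, hσB, hσL,
    Finset.sum_union h.disjoint.symm, Finset.mul_sum A,
    Finset.sum_congr rfl fun x hx => first_summand_eq h hσ hx,
    Finset.sum_congr rfl fun x hx => second_summand_eq h hσ hx, ← Finset.mul_sum, ← Finset.mul_sum,
    mul_zero, sub_zero, ← mul_add, ← sub_eq_add_neg, ← mul_sub]
  exact mul_right_inj' (pow_ne_zero _ (by norm_num))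

end Facet

/-! ### Consistent sets satisfy the homotopy formula -/

theorem sum_sub_insert_filter_lt {α β M : Type*} [DecidableEq α] [LinearOrder β]
    [AddCommGroup M] {f : α → β} {S : Finset α} (hf : Set.InjOn f S) (g : Finset α → M) :
    ∑ x ∈ S, (g (S.filter (f · < f x)) - g (insert x (S.filter (f · < f x)))) = g ∅ - g S := by
  induction S using Finset.induction_on_max_value f with
  | empty => simp
  | insert m S hm hmax ih =>
    have hlast : (insert m S).filter (f · < f m) = S := by
      rw [Finset.filter_insert, if_neg (lt_irrefl _), Finset.filter_eq_self]
      intro x hx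
      refine (hmax x hx).lt_of_ne fun h => hm ?_
      rwa [← hf (by simp [hx]) (by simp) h]
    have hpred : ∀ x ∈ S, (insert m S).filter (f · < f x) = S.filter (f · < f x) := fun x hx => by
      rw [Finset.filter_insert, if_neg (hmax x hx).not_gt]
    rw [Finset.sum_insert hm, hlast, Finset.sum_congr rfl fun x hx => by rw [hpred x hx],
      ih (hf.mono (by simp))]
    abel

open Classical in
theorem card_filter_lt_card_filter_iff {α : Type*} {r : α → α → Prop} {S : Finset α}
    (hirr : ∀ x, ¬ r x x) (htri : ∀ x y, x ≠ y → r x y ∨ r y x)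
    (htrans : ∀ x ∈ S, ∀ y ∈ S, ∀ z ∈ S, r x y → r y z → r x z) {x y : α}
    (hx : x ∈ S) (hy : y ∈ S) :
    (S.filter (r · x)).card < (S.filter (r · y)).card ↔ r x y := by
  have hmono : ∀ {x y}, x ∈ S → y ∈ S → r x y → S.filter (r · x) ⊆ S.filter (r · y) :=
    fun hx hy hxy z hz => by
      rw [Finset.mem_filter] at hz ⊢
      exact ⟨hz.1, htrans _ hz.1 _ hx _ hy hz.2 hxy⟩
  refine ⟨fun h => ?_, fun h => Finset.card_lt_card ((Finset.ssubset_iff_of_subset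
    (hmono hx hy h)).2 ⟨x, by simp [hx, h], by simp [hirr x]⟩)⟩
  rcases eq_or_ne x y with rfl | hne
  · exact absurd h (lt_irrefl _)
  · exact (htri x y hne).resolve_right fun hyx =>
      h.not_ge (Finset.card_le_card (hmono hy hx hyx))

/-- Compared in the order on the vertices outside `L` that is determined by `U`, the vertex `y`
precedes `x`. For `U = ∅` the order is the reverse of the given order of the vertices. -/
def Precedes (U : Set (Finset V)) (L : Finset V) (y x : V) : Prop :=
  y ≠ x ∧ (insert y (insert x L) ∈ U ↔ x < y)

theorem Precedes.irrefl (U : Set (Finset V)) (L : Finset V) (x : V) : ¬ Precedes U L x x :=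
  fun h => h.1 rfl

theorem Precedes.trichotomous (U : Set (Finset V)) (L : Finset V) (x y : V) (h : x ≠ y) :
    Precedes U L x y ∨ Precedes U L y x := by
  simp only [Precedes, Finset.insert_comm x y, ne_eq, h, h.symm, not_false_eq_true, true_and]
  rcases lt_or_gt_of_ne h with h' | h'
  · simp [h', h'.not_gt, em']
  · simp [h', h'.not_gt, em]

namespace ConsistentAt

variable {U : Set (Finset V)} {M : Finset V} {x y z : V}

theorem erase_mem_iff (hU : ConsistentAt U M) (hx : x ∈ M) (hy : y ∈ M) (hz : z ∈ M)
    (hxy : x < y) (hyz : y < z) (h : M.erase x ∈ U ↔ M.erase z ∈ U) :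
    M.erase y ∈ U ↔ M.erase x ∈ U := by
  rcases hU with hU | hU
  · exact ⟨fun hy' => h.2 (hU y hy z hz hyz hy'), hU x hx y hy hxy⟩
  · exact ⟨hU x hx y hy hxy, fun hx' => hU y hy z hz hyz (h.1 hx')⟩

theorem not_cycle (hU : ConsistentAt U M) (hx : x ∈ M) (hy : y ∈ M) (hz : z ∈ M)
    (hyx : y < x) (hzx : z < x) (hyz : y ≠ z) (hz' : M.erase z ∈ U ↔ y < x)
    (hx' : M.erase x ∈ U ↔ z < y) (hy' : M.erase y ∈ U ↔ x < z) : False := by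
  rcases lt_or_gt_of_ne hyz with h | h
  · have := hU.erase_mem_iff hy hz hx h hzx
    simp only [hx', hy', hz', hyx, hzx.not_gt, h.not_gt, iff_false, forall_const] at this
    exact this trivial
  · have := hU.erase_mem_iff hz hy hx h hyx
    simp only [hx', hy', hz', hyx, hzx.not_gt, h, forall_const] at this
    exact this.2 trivial

theorem precedes_trans {L : Finset V} (hx : x ∉ L) (hy : y ∉ L) (hz : z ∉ L)
    (hU : x ≠ y → x ≠ z → y ≠ z → ConsistentAt U (insert x (insert y (insert z L))))
    (h₁ : Precedes U L x y) (h₂ : Precedes U L y z) : Precedes U L x z := by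
  by_contra h
  have hxz : x ≠ z := by
    rintro rfl
    have := h₁.2.symm.trans (Finset.insert_comm x y L ▸ h₂.2)
    exact (lt_or_gt_of_ne h₁.1).elim (fun hlt => hlt.not_gt (this.2 hlt))
      (fun hlt => hlt.not_gt (this.1 hlt))
  have h₃ := (Precedes.trichotomous U L x z hxz).resolve_left h
  specialize hU h₁.1 hxz h₂.1
  set M := insert x (insert y (insert z L)) with hM
  have hxM : M.erase x = insert y (insert z L) := by grind [h₁.1]
  have hyM : M.erase y = insert z (insert x L) := by grind [h₁.1, h₂.1]
  have hzM : M.erase z = insert x (insert y L) := by grind [h₂.1]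
  have hx' : x ∈ M := by simp [hM]
  have hy' : y ∈ M := by simp [hM]
  have hz' : z ∈ M := by simp [hM]
  rw [Precedes, ← hzM] at h₁
  rw [Precedes, ← hxM] at h₂
  rw [Precedes, ← hyM] at h₃
  rcases lt_or_gt_of_ne h₁.1 with hxy | hxy
  · rcases lt_or_gt_of_ne h₂.1 with hyz | hyz
    · exact hU.not_cycle hz' hx' hy' (hxy.trans hyz) hyz h₁.1 h₃.2 h₁.2 h₂.2
    · exact hU.not_cycle hy' hz' hx' hyz hxy hxz.symm h₂.2 h₃.2 h₁.2
  · rcases lt_or_gt_of_ne hxz with hlt | hlt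
    · exact hU.not_cycle hz' hx' hy' hlt (hxy.trans hlt) h₁.1 h₃.2 h₁.2 h₂.2
    · exact hU.not_cycle hx' hy' hz' hxy hlt h₂.1 h₁.2 h₂.2 h₃.2

end ConsistentAt

theorem mem_initVertex {U : Set (Finset V)} {σ L : Finset V} {a : V} :
    a ∈ initVertex U σ L ↔ (a ∈ σ ∧ a ∉ L) ∧ (insert a L ∈ U ↔ EvenGap L a) := by
  simp only [initVertex, Finset.mem_filter, Finset.mem_sdiff, iff_iff_and_or_not_and_not]

theorem initVertex_subset {U : Set (Finset V)} {σ L : Finset V} : initVertex U σ L ⊆ σ \ L :=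
  fun _ ha => Finset.mem_sdiff.2 (mem_initVertex.1 ha).1

theorem initVertex_erase (U : Set (Finset V)) (σ L : Finset V) (w : V) :
    initVertex U (σ.erase w) L = (initVertex U σ L).erase w := by
  ext a
  simp only [Finset.mem_erase, mem_initVertex, and_assoc]

open Classical in
/-- The facet with initial vertex `A`, in coordinates in which the bottom vertex of every direction
is the origin: a direction `x` belongs to it if the facet is at the end of the direction `x`. -/
def facetCoord (σ L A : Finset V) : Finset V := (σ \ L).filter fun x => x ∈ A ↔ EvenGap L x

section FacetCoord

variable {U : Set (Finset V)} {σ L A : Finset V}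

theorem mem_facetCoord {x : V} :
    x ∈ facetCoord σ L A ↔ (x ∈ σ ∧ x ∉ L) ∧ (x ∈ A ↔ EvenGap L x) := by
  classical rw [facetCoord, Finset.mem_filter, Finset.mem_sdiff]

theorem facetCoord_eq_empty (hA : A ⊆ σ \ L) : facetCoord σ L A = ∅ ↔ A = initVertex ∅ σ L := by
  rw [Finset.eq_empty_iff_forall_notMem, Finset.ext_iff]
  refine forall_congr' fun a => ?_
  have := @hA a
  simp only [mem_facetCoord, mem_initVertex, Finset.mem_sdiff, Set.mem_empty_iff_false,
    false_iff] at this ⊢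
  tauto

theorem facetCoord_eq_sdiff : facetCoord σ L A = σ \ L ↔ σ \ (L ∪ A) = initVertex ∅ σ L := by
  rw [Finset.ext_iff, Finset.ext_iff]
  refine forall_congr' fun a => ?_
  simp only [mem_facetCoord, mem_initVertex, Finset.mem_sdiff, Finset.mem_union,
    Set.mem_empty_iff_false, false_iff]
  tauto

open Classical in
theorem erase_eq_initVertex_iff (hA : A ⊆ σ \ L) {x : V} (hxL : x ∉ L) :
    A.erase x = initVertex U σ (insert x L) ↔
      (facetCoord σ L A).erase x = (σ \ L).filter (Precedes U L · x) := by
  rw [Finset.ext_iff, Finset.ext_iff]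
  refine forall_congr' fun y => ?_
  have := @hA y
  rcases eq_or_ne y x with rfl | hyx
  · simp [mem_initVertex, Precedes.irrefl]
  · have hlt : ¬ y < x ↔ x < y := not_lt.trans hyx.symm.le_iff_lt
    simp only [mem_initVertex, evenGap_insert hxL, mem_facetCoord, Finset.mem_erase,
      Finset.mem_sdiff, Finset.mem_insert, Precedes, hlt] at this ⊢
    grind

open Classical in
theorem facetSign_mul_cubeCoeff_coproductCoeff {k : ℕ} (hL : L ⊆ σ) (hcard : L.card + 1 = k)
    (hA : A ⊆ σ \ L) {x : V} (hx : x ∈ σ \ L) :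
    facetSign L A x * cubeCoeff (coproductCoeff k U) σ (insert x L) (A.erase x) =
      (if facetCoord σ L A = (σ \ L).filter (Precedes U L · x) then 1 else 0) -
        if facetCoord σ L A = insert x ((σ \ L).filter (Precedes U L · x)) then 1 else 0 := by
  obtain ⟨hxσ, hxL⟩ := Finset.mem_sdiff.1 hx
  have hcube : IsCube (insert x L) (A.erase x) (σ \ (insert x L ∪ A.erase x)) :=
    .of_subset fun a ha => by have := @hA a; grind
  have hσ : insert x L ∪ A.erase x ∪ σ \ (insert x L ∪ A.erase x) = σ :=
    Finset.union_sdiff_of_subset (by grind)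
  have hcoeff : cubeCoeff (coproductCoeff k U) σ (insert x L) (A.erase x) =
      if (facetCoord σ L A).erase x = (σ \ L).filter (Precedes U L · x) then 1 else 0 := by
    rw [cubeCoeff, show σ \ A.erase x = insert x L ∪ σ \ (insert x L ∪ A.erase x) by grind,
      coproductCoeff_union_union hcube]
    simp only [hσ, Finset.card_insert_of_notMem hxL, hcard, true_and,
      erase_eq_initVertex_iff hA hxL, mul_ite, neg_one_pow_mul_self, mul_zero]
  have hpred : x ∉ (σ \ L).filter (Precedes U L · x) := by simp [Precedes.irrefl]
  have hsign : facetSign L A x = if x ∈ facetCoord σ L A then -1 else 1 := by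
    simp [facetSign, mem_facetCoord, hxσ, hxL]
  rw [hcoeff, hsign]
  by_cases hmem : x ∈ facetCoord σ L A
  · have hne : facetCoord σ L A ≠ (σ \ L).filter (Precedes U L · x) := fun h => hpred (h ▸ hmem)
    simp only [if_pos hmem, if_neg hne, Finset.erase_eq_iff_eq_insert hmem hpred, neg_one_mul,
      zero_sub]
  · have hne : facetCoord σ L A ≠ insert x ((σ \ L).filter (Precedes U L · x)) := fun h =>
      hmem (h ▸ Finset.mem_insert_self _ _)
    simp only [if_neg hmem, if_neg hne, Finset.erase_eq_of_notMem hmem, one_mul, sub_zero]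

theorem cubicalFormula_coproductCoeff {i : ℕ}
    (hU : ∀ M ⊆ σ, M.card = i + 3 → ConsistentAt U M) (hL : L ⊆ σ) (hcard : L.card = i)
    (hA : A ⊆ σ \ L) : CubicalFormula (coproductCoeff (i + 1) U) σ L A := by
  classical
  let rank : V → ℕ := fun x => ((σ \ L).filter (Precedes U L · x)).card
  have hrank : ∀ x ∈ σ \ L, ∀ y ∈ σ \ L, rank x < rank y ↔ Precedes U L x y := fun x hx y hy => by
    refine card_filter_lt_card_filter_iff (Precedes.irrefl U L) (Precedes.trichotomous U L) ?_ hx hy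
    intro x hx y hy z hz
    rw [Finset.mem_sdiff] at hx hy hz
    refine ConsistentAt.precedes_trans hx.2 hy.2 hz.2 fun hxy hxz hyz => hU _ ?_ ?_
    · simp only [Finset.insert_subset_iff]
      exact ⟨hx.1, hy.1, hz.1, hL⟩
    · rw [Finset.card_insert_of_notMem (by simp [hxy, hxz, hx.2]),
        Finset.card_insert_of_notMem (by simp [hyz, hy.2]), Finset.card_insert_of_notMem hz.2,
        hcard]
  have hinj : Set.InjOn rank (σ \ L : Finset V) := fun x hx y hy h => by
    by_contra hne
    rcases Precedes.trichotomous U L x y hne with h' | h'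
    · exact h.not_lt ((hrank x hx y hy).2 h')
    · exact h.not_gt ((hrank y hy x hx).2 h')
  have hfilter : ∀ x ∈ σ \ L,
      (σ \ L).filter (Precedes U L · x) = (σ \ L).filter (rank · < rank x) := fun x hx =>
    Finset.filter_congr fun y hy => (hrank y hy x hx).symm
  rw [CubicalFormula, Finset.sum_congr rfl fun x hx => by
      rw [facetSign_mul_cubeCoeff_coproductCoeff hL (by rw [hcard]) hA hx, hfilter x hx],
    sum_sub_insert_filter_lt hinj fun P => if facetCoord σ L A = P then (1 : ℤ) else 0]
  simp only [facetCoord_eq_empty hA, facetCoord_eq_sdiff]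

end FacetCoord

section Extension

variable {i : ℕ} {U : Set (Finset V)} {ρ X Y : Finset V} {w : V}

theorem coproductCoeff_eq_zero_of_union_ne {k : ℕ} {τ : Finset V} (h : X ∪ Y ≠ τ) :
    coproductCoeff k U τ X Y = 0 := if_neg fun h' => h h'.1

theorem sum_insert_left_coproductCoeff {k : ℕ} (hρ : X ∪ Y = ρ) (hw : w ∉ ρ) :
    ∑ x ∈ insert w ρ \ X, (-1) ^ below X x * coproductCoeff k U (insert w ρ) (insert x X) Y =
      (-1) ^ below X w * coproductCoeff k U (insert w ρ) (insert w X) Y := by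
  refine Finset.sum_eq_single_of_mem w (by grind) fun x _ hxw => ?_
  rw [coproductCoeff_eq_zero_of_union_ne, mul_zero]
  intro h
  have := h ▸ Finset.mem_insert_self w ρ
  grind

theorem sum_insert_right_coproductCoeff {k : ℕ} (hρ : X ∪ Y = ρ) (hw : w ∉ ρ) :
    ∑ y ∈ insert w ρ \ Y, (-1) ^ below Y y * coproductCoeff k U (insert w ρ) X (insert y Y) =
      (-1) ^ below Y w * coproductCoeff k U (insert w ρ) X (insert w Y) := by
  refine Finset.sum_eq_single_of_mem w (by grind) fun y _ hyw => ?_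
  rw [coproductCoeff_eq_zero_of_union_ne, mul_zero]
  intro h
  have := h ▸ Finset.mem_insert_self w ρ
  grind

theorem sum_erase_coproductCoeff {k : ℕ} (hρ : X ∪ Y = ρ) (hw : w ∉ ρ) :
    ∑ x ∈ insert w ρ,
        (-1) ^ below (insert w ρ) x * coproductCoeff k U ((insert w ρ).erase x) X Y =
      (-1) ^ below ρ w * coproductCoeff k U ρ X Y := by
  rw [Finset.sum_eq_single_of_mem w (Finset.mem_insert_self _ _), below_insert_self,
    Finset.erase_insert hw]
  intro x _ hxw
  rw [coproductCoeff_eq_zero_of_union_ne, mul_zero]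
  rw [hρ]
  exact fun h => hw (h ▸ Finset.mem_erase.2 ⟨hxw.symm, Finset.mem_insert_self w ρ⟩)

theorem coeffHomotopyFormula_coproductCoeff_insert_iff {k : ℕ} (hρ : X ∪ Y = ρ) (hw : w ∉ ρ) :
    CoeffHomotopyFormula (coproductCoeff k U) i (insert w ρ) X Y ↔
      (-1) ^ below X w * coproductCoeff k U (insert w ρ) (insert w X) Y +
          (-1) ^ (X.card - 1) *
            ((-1) ^ below Y w * coproductCoeff k U (insert w ρ) X (insert w Y)) =
        (-1) ^ i * ((-1) ^ below ρ w * coproductCoeff k U ρ X Y) := by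
  have hne : X ∪ Y ≠ insert w ρ := fun h =>
    hw (hρ.symm.trans h ▸ Finset.mem_insert_self w ρ)
  have hne' : Y ∪ X ≠ insert w ρ := by rwa [Finset.union_comm]
  rw [CoeffHomotopyFormula, sum_insert_left_coproductCoeff hρ hw,
    sum_insert_right_coproductCoeff hρ hw, sum_erase_coproductCoeff hρ hw,
    coproductCoeff_eq_zero_of_union_ne hne, coproductCoeff_eq_zero_of_union_ne hne', mul_zero,
    mul_zero, add_zero, sub_eq_zero]

theorem coeffHomotopyFormula_coproductCoeff_insert {L A B : Finset V} (h : IsCube L A B)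
    (hL : L.card = i + 1) (hw : w ∉ L ∪ A ∪ B) :
    CoeffHomotopyFormula (coproductCoeff (i + 1) U) i (insert w (L ∪ A ∪ B)) (L ∪ A) (L ∪ B) := by
  set τ := insert w (L ∪ A ∪ B) with hτ
  have hwA : w ∉ A := by grind
  have hwB : w ∉ B := by grind
  have hρ : L ∪ A ∪ (L ∪ B) = L ∪ A ∪ B := by
    rw [← Finset.union_union_distrib_left, Finset.union_assoc]
  have hcard : τ.card = (L ∪ A ∪ B).card + 1 := Finset.card_insert_of_notMem hw
  have hinit : initVertex U (L ∪ A ∪ B) L = (initVertex U τ L).erase w := by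
    rw [← initVertex_erase, hτ, Finset.erase_insert hw]
  have hA : IsCube L (insert w A) B := h.insert_left (by grind)
  have hB : IsCube L A (insert w B) := (h.symm.insert_left (by grind)).symm
  have hsignA := sign_extend_left h hwA hwB (by omega) h.card_union_union
  have hsignB := sign_extend_right (m := (L ∪ A ∪ B).card) h hwB (by omega)
  rw [show L.card - 1 = i by omega, ← hcard] at hsignA hsignB
  have hvalA : coproductCoeff (i + 1) U τ (insert w (L ∪ A)) (L ∪ B) =
      if insert w A = initVertex U τ L then (-1) ^ signExp τ.card L (insert w A) B else 0 := by
    rw [← Finset.union_insert, coproductCoeff_union_union hA]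
    simp only [Finset.union_insert, Finset.insert_union, ← hτ, hL, true_and]
  have hvalB : coproductCoeff (i + 1) U τ (L ∪ A) (insert w (L ∪ B)) =
      if A = initVertex U τ L then (-1) ^ signExp τ.card L A (insert w B) else 0 := by
    rw [← Finset.union_insert, coproductCoeff_union_union hB]
    simp only [Finset.union_insert, ← hτ, hL, true_and]
  have hval : coproductCoeff (i + 1) U (L ∪ A ∪ B) (L ∪ A) (L ∪ B) =
      if A = (initVertex U τ L).erase w then (-1) ^ signExp (L ∪ A ∪ B).card L A B else 0 := by
    rw [coproductCoeff_union_union h]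
    simp only [hL, true_and, hinit]
  rw [hτ, coeffHomotopyFormula_coproductCoeff_insert_iff hρ hw, ← hτ, hvalA, hvalB, hval]
  by_cases hwi : w ∈ initVertex U τ L
  · have hneA : A ≠ initVertex U τ L := fun h => hwA (h ▸ hwi)
    have hiff : A = (initVertex U τ L).erase w ↔ insert w A = initVertex U τ L := by
      rw [eq_comm, Finset.erase_eq_iff_eq_insert hwi hwA, eq_comm]
    simp only [if_neg hneA, hiff]
    split_ifs
    · linear_combination hsignA
    · ring
  · have hneA : insert w A ≠ initVertex U τ L := fun h => hwi (h ▸ Finset.mem_insert_self w A)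
    rw [if_neg hneA, Finset.erase_eq_of_notMem hwi]
    split_ifs
    · linear_combination hsignB
    · ring

end Extension

theorem facet_or_face_of_insert {τ X Y : Finset V} {i : ℕ} {x : V} (hx : x ∉ X)
    (hunion : insert x X ∪ Y = τ) (hcard : (insert x X ∩ Y).card = i + 1) :
    (X ∪ Y = τ ∧ (X ∩ Y).card = i) ∨ x ∉ X ∪ Y ∧ insert x (X ∪ Y) = τ ∧ (X ∩ Y).card = i + 1 := by
  rw [Finset.insert_union] at hunion
  by_cases hxY : x ∈ Y
  · rw [Finset.insert_inter_of_mem hxY, Finset.card_insert_of_notMem (by simp [hx])] at hcard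
    rw [Finset.insert_eq_of_mem (Finset.mem_union_right _ hxY)] at hunion
    exact .inl ⟨hunion, by omega⟩
  · rw [Finset.insert_inter_of_notMem hxY] at hcard
    exact .inr ⟨by simp [hx, hxY], hunion, hcard⟩

theorem coeffHomotopyFormula_coproductCoeff_of_not {i : ℕ} {U : Set (Finset V)}
    {τ X Y : Finset V} (hfacet : ¬ (X ∪ Y = τ ∧ (X ∩ Y).card = i))
    (hface : ¬ ∃ w ∉ X ∪ Y, insert w (X ∪ Y) = τ ∧ (X ∩ Y).card = i + 1) :
    CoeffHomotopyFormula (coproductCoeff (i + 1) U) i τ X Y := by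
  have hzero : ∀ x, x ∉ X → coproductCoeff (i + 1) U τ (insert x X) Y = 0 := fun x hx => by
    by_contra h
    obtain ⟨hunion, hcard, -⟩ := eq_of_coproductCoeff_ne_zero h
    exact (facet_or_face_of_insert hx hunion hcard).elim hfacet fun h => hface ⟨x, h⟩
  have hzero' : ∀ y, y ∉ Y → coproductCoeff (i + 1) U τ X (insert y Y) = 0 := fun y hy => by
    by_contra h
    obtain ⟨hunion, hcard, -⟩ := eq_of_coproductCoeff_ne_zero h
    rw [Finset.union_comm] at hunion
    rw [Finset.inter_comm] at hcard
    have := facet_or_face_of_insert hy hunion hcard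
    rw [Finset.union_comm, Finset.inter_comm] at this
    exact this.elim hfacet fun h => hface ⟨y, h⟩
  have hzero'' : ∀ w ∈ τ, coproductCoeff (i + 1) U (τ.erase w) X Y = 0 := fun w hw => by
    by_contra h
    obtain ⟨hunion, hcard, -⟩ := eq_of_coproductCoeff_ne_zero h
    exact hface ⟨w, by simp [hunion], by rw [hunion, Finset.insert_erase hw], hcard⟩
  rw [CoeffHomotopyFormula,
    Finset.sum_eq_zero fun x hx => by rw [hzero x (Finset.mem_sdiff.1 hx).2, mul_zero],
    Finset.sum_eq_zero fun y hy => by rw [hzero' y (Finset.mem_sdiff.1 hy).2, mul_zero],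
    Finset.sum_eq_zero fun w hw => by rw [hzero'' w hw, mul_zero],
    coproductCoeff, coproductCoeff, if_neg fun h => hfacet ⟨h.1, h.2.1⟩, if_neg fun h => hfacet
      ⟨Finset.union_comm X Y ▸ h.1, Finset.inter_comm X Y ▸ h.2.1⟩]
  ring

theorem coeffHomotopyFormula_coproductCoeff {i : ℕ} {U : Set (Finset V)} {τ X Y : Finset V}
    (hU : ∀ M ⊆ τ, M.card = i + 3 → ConsistentAt U M) (hX : X.Nonempty) (hY : Y.Nonempty) :
    CoeffHomotopyFormula (coproductCoeff (i + 1) U) i τ X Y := by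
  have hcube := IsCube.of_inter X Y
  have eX : X ∩ Y ∪ X \ Y = X := by grind
  have eY : X ∩ Y ∪ Y \ X = Y := by grind
  have eXY : X ∩ Y ∪ X \ Y ∪ Y \ X = X ∪ Y := by grind
  by_cases hfacet : X ∪ Y = τ ∧ (X ∩ Y).card = i
  · obtain ⟨rfl, hcard⟩ := hfacet
    have key := coeffHomotopyFormula_iff_cubicalFormula (c := coproductCoeff (i + 1) U) hcube
      eXY hcard (by rwa [eX]) (by rwa [eY]) fun w hw =>
        coproductCoeff_eq_zero_of_union_ne fun h => by grind
    rw [eX, eY] at key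
    exact key.2 (cubicalFormula_coproductCoeff hU (by grind) hcard (by grind))
  by_cases hface : ∃ w ∉ X ∪ Y, insert w (X ∪ Y) = τ ∧ (X ∩ Y).card = i + 1
  · obtain ⟨w, hw, rfl, hcard⟩ := hface
    rw [← eXY] at hw
    have key := coeffHomotopyFormula_coproductCoeff_insert (U := U) hcube hcard hw
    rwa [eXY, eX, eY] at key
  exact coeffHomotopyFormula_coproductCoeff_of_not hfacet hface

/-! ### From linear maps to coefficients -/

section Boundary

variable {K : PreAbstractSimplicialComplex V}

theorem boundary_chain {s : Finset V} (hs : s ∈ K.faces) :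
    boundary K (chain K s) = ∑ v ∈ s, (-1 : ℤ) ^ below s v • chain K (s.erase v) := by
  rw [chain_of_mem hs, boundary, Finsupp.linearCombination_single, one_smul]
  rfl

theorem chainCoeff_chain_erase {s t : Finset V} {x : V} (hs : s ∈ K.faces) (ht : t ∈ K.faces)
    (hx : x ∈ t) :
    chainCoeff K s (chain K (t.erase x)) =
      if x ∉ s then chainCoeff K (insert x s) (chain K t) else 0 := by
  by_cases hxt : t.erase x ∈ K.faces
  · rw [chainCoeff_chain hxt, chainCoeff_chain ht]
    grind
  · rw [chain_of_notMem hxt, map_zero, chainCoeff_chain ht]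
    have hne : s ≠ t.erase x := fun h => hxt (h ▸ hs)
    grind

theorem chainCoeff_boundary {s : Finset V} (hs : s ∈ K.faces) (a : Chains K) :
    ∀ᶠ S : Finset V in Filter.atTop, chainCoeff K s (boundary K a) =
      ∑ x ∈ S \ s, (-1) ^ below s x * chainCoeff K (insert x s) a := by
  induction a using Finsupp.induction_linear with
  | zero => simp
  | add a b ha hb =>
    filter_upwards [ha, hb] with S ha hb
    simp only [map_add, ha, hb, mul_add, Finset.sum_add_distrib]
  | single t n =>
    filter_upwards [Filter.eventually_ge_atTop t.1] with S hS
    rw [← mul_one n, ← smul_eq_mul, ← Finsupp.smul_single, ← chain_coe]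
    simp only [map_smul, boundary_chain t.2, map_sum, smul_eq_mul, mul_left_comm _ n]
    rw [← Finset.mul_sum]
    congr 1
    rw [Finset.sum_congr rfl fun x hx => by rw [chainCoeff_chain_erase hs t.2 hx]]
    simp only [mul_ite, mul_zero]
    rw [← Finset.sum_filter]
    refine Finset.sum_subset_zero_on_sdiff (fun x hx => by grind) (fun x hx => ?_) fun x hx => ?_
    · rw [chainCoeff_chain t.2, if_neg (by grind), mul_zero]
    · rw [Finset.mem_filter] at hx
      by_cases h : insert x s = t.1
      · rw [← h, below_insert_self]
      · rw [chainCoeff_chain t.2, if_neg h, mul_zero, mul_zero]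

theorem tensorBoundary_tmul (a b : Chains K) :
    tensorBoundary K (a ⊗ₜ[ℤ] b) = boundary K a ⊗ₜ[ℤ] b + signMap K a ⊗ₜ[ℤ] boundary K b := rfl

theorem tensorCoeff_tensorBoundary {X Y : Finset V} (hX : X ∈ K.faces) (hY : Y ∈ K.faces)
    (z : Chains K ⊗[ℤ] Chains K) :
    ∀ᶠ S : Finset V in Filter.atTop, tensorCoeff K X Y (tensorBoundary K z) =
      ∑ x ∈ S \ X, (-1) ^ below X x * tensorCoeff K (insert x X) Y z +
        (-1) ^ (X.card - 1) *
          ∑ y ∈ S \ Y, (-1) ^ below Y y * tensorCoeff K X (insert y Y) z := by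
  induction z using TensorProduct.induction_on with
  | zero => simp
  | tmul a b =>
    filter_upwards [chainCoeff_boundary hX a, chainCoeff_boundary hY b] with S ha hb
    simp only [tensorBoundary_tmul, map_add, tensorCoeff_tmul, ha, hb, chainCoeff_signMap,
      Finset.sum_mul, Finset.mul_sum, mul_assoc, mul_left_comm (chainCoeff K X a)]
  | add z z' hz hz' =>
    filter_upwards [hz, hz'] with S hz hz'
    simp only [map_add, hz, hz', mul_add, Finset.sum_add_distrib]
    ring

end Boundary

/-- The homotopy formula on the simplex `τ`. -/
def HomotopyFormulaAt (K : PreAbstractSimplicialComplex V) (i : ℕ)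
    (D : Chains K →ₗ[ℤ] Chains K ⊗[ℤ] Chains K) (τ : Finset V) : Prop :=
  tensorBoundary K (D (chain K τ)) - (-1 : ℤ) ^ i • D (boundary K (chain K τ)) =
    prevCoproduct K i (chain K τ) + (-1 : ℤ) ^ i • swap K (prevCoproduct K i (chain K τ))

section HomotopyFormula

variable {K : PreAbstractSimplicialComplex V} {i : ℕ} {U : Set (Finset V)} {τ X Y : Finset V}
  {D : Chains K →ₗ[ℤ] Chains K ⊗[ℤ] Chains K}

theorem homotopyFormula_iff : HomotopyFormula K i D ↔ ∀ τ ∈ K.faces, HomotopyFormulaAt K i D τ :=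
  ⟨fun h τ _ => LinearMap.congr_fun h (chain K τ), fun h => linearMap_ext h⟩

theorem initVertex_restrict {σ L : Finset V} (hL : L ⊆ σ) (hcard : L.card = i + 1) :
    initVertex (restrict i U σ) σ L = initVertex U σ L := by
  ext a
  rw [mem_initVertex, mem_initVertex]
  refine and_congr_right fun ⟨ha, haL⟩ => ?_
  have : insert a L ∈ restrict i U σ ↔ insert a L ∈ U := by
    simp [restrict, Finset.insert_subset_iff, ha, hL, Finset.card_insert_of_notMem haL, hcard]
  rw [this]

theorem isCube_initVertex (U : Set (Finset V)) (σ L : Finset V) :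
    IsCube L (initVertex U σ L) (coVertex U σ L) :=
  IsCube.of_subset initVertex_subset

theorem union_initVertex_union_coVertex {L : Finset V} (hL : L ⊆ τ) :
    L ∪ initVertex U τ L ∪ coVertex U τ L = τ :=
  Finset.union_sdiff_of_subset <| Finset.union_subset hL <|
    initVertex_subset.trans Finset.sdiff_subset

theorem eq_union_vertices_iff {L : Finset V} (hL : L ⊆ τ) :
    X = L ∪ initVertex U τ L ∧ Y = L ∪ coVertex U τ L ↔
      L = X ∩ Y ∧ X ∪ Y = τ ∧ X \ Y = initVertex U τ L := by
  have hcube := isCube_initVertex U τ L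
  constructor
  · rintro ⟨rfl, rfl⟩
    rw [hcube.union_inter_union, hcube.union_sdiff_union, ← Finset.union_union_distrib_left,
      ← Finset.union_assoc]
    exact ⟨rfl, union_initVertex_union_coVertex hL, rfl⟩
  · rintro ⟨hinter, rfl, hsdiff⟩
    rw [coVertex, ← hsdiff, hinter]
    exact ⟨by grind, by grind⟩

theorem tensorCoeff_simplexCoproduct_term (hτ : τ ∈ K.faces) {L : Finset V}
    (hL : L ∈ τ.powersetCard (i + 1)) :
    tensorCoeff K X Y ((-1 : ℤ) ^ signExp τ.card L (initVertex U τ L) (coVertex U τ L) •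
        (chain K (L ∪ initVertex U τ L) ⊗ₜ[ℤ] chain K (L ∪ coVertex U τ L))) =
      if L = X ∩ Y then coproductCoeff (i + 1) U τ X Y else 0 := by
  obtain ⟨hsub, hcard⟩ := Finset.mem_powersetCard.1 hL
  have hne : L.Nonempty := Finset.card_pos.1 (by omega)
  have hface : ∀ S, L ∪ S ⊆ τ → L ∪ S ∈ K.faces := fun S hS =>
    mem_faces_of_subset hτ hS (hne.mono Finset.subset_union_left)
  have hτ' := union_initVertex_union_coVertex (U := U) hsub
  rw [map_zsmul, tensorCoeff_tmul_chain (hface _ (by grind)) (hface _ (by grind))]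
  simp only [eq_union_vertices_iff hsub]
  by_cases hinter : L = X ∩ Y
  · subst hinter
    simp only [coproductCoeff, hcard, true_and, if_true]
    split_ifs with h
    · obtain ⟨rfl, hsdiff⟩ := h
      rw [coVertex, ← hsdiff, show (X ∪ Y) \ (X ∩ Y ∪ X \ Y) = Y \ X by grind, smul_eq_mul, mul_one]
    · rw [smul_zero]
  · rw [if_neg fun h => hinter h.1, if_neg hinter, smul_zero]

theorem mapCoeff_coproduct (hτ : τ ∈ K.faces) :
    mapCoeff (coproduct K i U) τ X Y = coproductCoeff (i + 1) U τ X Y := by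
  have hval : coproduct K i U (chain K τ) = simplexCoproduct K i (restrict i U τ) τ := by
    rw [chain_of_mem hτ, coproduct, Finsupp.linearCombination_single, one_smul]
  have hterm : ∀ L ∈ τ.powersetCard (i + 1),
      tensorCoeff K X Y ((-1 : ℤ) ^ signExp τ.card L (initVertex (restrict i U τ) τ L)
        (coVertex (restrict i U τ) τ L) • (chain K (L ∪ initVertex (restrict i U τ) τ L) ⊗ₜ[ℤ]
          chain K (L ∪ coVertex (restrict i U τ) τ L))) =
      if L = X ∩ Y then coproductCoeff (i + 1) U τ X Y else 0 := fun L hL => by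
    obtain ⟨hsub, hcard⟩ := Finset.mem_powersetCard.1 hL
    rw [coVertex, initVertex_restrict hsub hcard]
    exact tensorCoeff_simplexCoproduct_term hτ hL
  rw [mapCoeff, hval, simplexCoproduct, map_sum, Finset.sum_congr rfl hterm, Finset.sum_ite_eq',
    ite_eq_left_iff]
  refine fun h => (not_imp_comm.1 eq_of_coproductCoeff_ne_zero fun ⟨hunion, hcard, _⟩ => h ?_).symm
  exact Finset.mem_powersetCard.2
    ⟨hunion ▸ Finset.inter_subset_left.trans Finset.subset_union_left, hcard⟩

theorem coproductCoeff_zero_empty (hX : X.Nonempty) : coproductCoeff 0 ∅ τ X Y = 0 := by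
  by_contra h
  obtain ⟨-, hinter, hsdiff⟩ := eq_of_coproductCoeff_ne_zero h
  rw [Finset.card_eq_zero] at hinter
  have hempty : X \ Y = ∅ := by
    rw [hsdiff, hinter]
    ext a
    simp [mem_initVertex, EvenGap]
  exact hX.ne_empty (by rw [← Finset.sdiff_union_inter X Y, hempty, hinter, Finset.empty_union])

theorem mapCoeff_prevCoproduct (hτ : τ ∈ K.faces) (hX : X.Nonempty) :
    mapCoeff (prevCoproduct K i) τ X Y = coproductCoeff i ∅ τ X Y := by
  cases i with
  | succ i => exact mapCoeff_coproduct hτ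
  | zero => simp [coproductCoeff_zero_empty hX, mapCoeff, prevCoproduct]

theorem IsLocalAt.tensorCoeff_tensorBoundary (hD : IsLocalAt D τ) (hX : X ∈ K.faces)
    (hY : Y ∈ K.faces) :
    tensorCoeff K X Y (tensorBoundary K (D (chain K τ))) =
      ∑ x ∈ τ \ X, (-1) ^ below X x * mapCoeff D τ (insert x X) Y +
        (-1) ^ (X.card - 1) * ∑ y ∈ τ \ Y, (-1) ^ below Y y * mapCoeff D τ X (insert y Y) := by
  obtain ⟨S, hS, hτS⟩ := ((CupCoproduct.tensorCoeff_tensorBoundary hX hY (D (chain K τ))).and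
    (Filter.eventually_ge_atTop τ)).exists
  rw [hS]
  congr 1
  · refine (Finset.sum_subset (Finset.sdiff_subset_sdiff hτS subset_rfl) fun x _ hx => ?_).symm
    rw [mul_eq_zero]
    refine .inr (not_imp_comm.1 (hD _ _) fun h => hx ?_)
    grind
  · congr 1
    refine (Finset.sum_subset (Finset.sdiff_subset_sdiff hτS subset_rfl) fun y _ hy => ?_).symm
    rw [mul_eq_zero]
    refine .inr (not_imp_comm.1 (hD _ _) fun h => hy ?_)
    grind

theorem homotopyFormulaAt_iff (hτ : τ ∈ K.faces) (hD : IsLocalAt D τ) :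
    HomotopyFormulaAt K i D τ ↔
      ∀ X ∈ K.faces, ∀ Y ∈ K.faces, CoeffHomotopyFormula (mapCoeff D) i τ X Y := by
  have key : ∀ X ∈ K.faces, ∀ Y ∈ K.faces,
      (tensorCoeff K X Y
        (tensorBoundary K (D (chain K τ)) - (-1 : ℤ) ^ i • D (boundary K (chain K τ))) =
      tensorCoeff K X Y
        (prevCoproduct K i (chain K τ) + (-1 : ℤ) ^ i • swap K (prevCoproduct K i (chain K τ)))) ↔
      CoeffHomotopyFormula (mapCoeff D) i τ X Y := by
    intro X hX Y hY
    rw [CoeffHomotopyFormula, map_sub, map_add, hD.tensorCoeff_tensorBoundary hX hY, map_zsmul,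
      map_zsmul, tensorCoeff_swap, ← mapCoeff_prevCoproduct hτ (nonempty_of_mem_faces hX),
      ← mapCoeff_prevCoproduct hτ (nonempty_of_mem_faces hY), boundary_chain hτ]
    simp only [map_sum, map_smul, map_zsmul, smul_eq_mul, mapCoeff]
  exact ⟨fun h X hX Y hY => (key X hX Y hY).1 (congrArg _ h),
    fun h => tensor_ext fun X hX Y hY => (key X hX Y hY).2 (h X hX Y hY)⟩

theorem isLocalAt_coproduct (hτ : τ ∈ K.faces) : IsLocalAt (coproduct K i U) τ := fun _ _ h =>
  subset_of_coproductCoeff_ne_zero ((mapCoeff_coproduct hτ).symm.trans_ne h)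

theorem isLocalAt_prevCoproduct (hτ : τ ∈ K.faces) : IsLocalAt (prevCoproduct K i) τ := by
  cases i with
  | zero => exact fun X Y h => absurd (map_zero _) h
  | succ i => exact isLocalAt_coproduct hτ

theorem mapCoeff_coproduct_erase (hτ : τ ∈ K.faces) {w : V} (hX : X.Nonempty) :
    mapCoeff (coproduct K i U) (τ.erase w) X Y = coproductCoeff (i + 1) U (τ.erase w) X Y := by
  by_cases hw : (τ.erase w).Nonempty
  · exact mapCoeff_coproduct (mem_faces_of_subset hτ (Finset.erase_subset _ _) hw)
  · rw [Finset.not_nonempty_iff_eq_empty] at hw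
    rw [hw, mapCoeff, chain_empty, map_zero, map_zero, coproductCoeff_eq_zero_of_union_ne]
    exact (hX.mono Finset.subset_union_left).ne_empty

theorem homotopyFormula_coproduct (hU : IsConsistent K i U) :
    HomotopyFormula K i (coproduct K i U) := by
  refine homotopyFormula_iff.2 fun τ hτ =>
    (homotopyFormulaAt_iff hτ (isLocalAt_coproduct hτ)).2 fun X hX Y hY => ?_
  have hconsistent : ∀ M ⊆ τ, M.card = i + 3 → ConsistentAt U M := fun M hM hcard =>
    hU.2 M (mem_faces_of_subset hτ hM (Finset.card_pos.1 (by omega))) hcard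
  have := coeffHomotopyFormula_coproductCoeff hconsistent (nonempty_of_mem_faces hX)
    (nonempty_of_mem_faces hY)
  simpa only [CoeffHomotopyFormula, mapCoeff_coproduct hτ,
    mapCoeff_coproduct_erase hτ (nonempty_of_mem_faces hX)] using this

end HomotopyFormula

/-! ### Every local solution has a term for each generating set -/

theorem sum_sum_erase_eq_zero {ι M : Type*} [DecidableEq ι] [AddCommGroup M] [IsAddTorsionFree M]
    {s : Finset ι} {f : ι → ι → M} (hf : ∀ x ∈ s, ∀ y ∈ s, x ≠ y → f x y = -f y x) :
    ∑ x ∈ s, ∑ y ∈ s.erase x, f x y = 0 := by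
  refine self_eq_neg.1 ?_
  calc ∑ x ∈ s, ∑ y ∈ s.erase x, f x y = ∑ y ∈ s, ∑ x ∈ s.erase y, f x y :=
        Finset.sum_comm' fun x y => by grind
    _ = -∑ y ∈ s, ∑ x ∈ s.erase y, f y x := by
        simp only [← Finset.sum_neg_distrib]
        exact Finset.sum_congr rfl fun y hy => Finset.sum_congr rfl fun x hx =>
          hf x (Finset.mem_of_mem_erase hx) y hy (Finset.ne_of_mem_erase hx)

theorem sum_facetSign_mul_eq_zero {S L : Finset V} {x : V} (hx : x ∈ S) (g : Finset V → ℤ) :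
    ∑ A ∈ S.powerset, facetSign L A x * g (A.erase x) = 0 := by
  rw [← Finset.insert_erase hx, Finset.sum_powerset_insert (Finset.notMem_erase x S),
    ← Finset.sum_add_distrib]
  refine Finset.sum_eq_zero fun A hA => ?_
  have hxA : x ∉ A := fun h => Finset.notMem_erase x S (Finset.mem_powerset.1 hA h)
  rw [Finset.erase_insert hxA, Finset.erase_eq_of_notMem hxA, facetSign_of_notMem hxA,
    facetSign_of_mem (Finset.mem_insert_self x A)]
  ring

theorem sum_powerset_erase {S : Finset V} {x : V} (hx : x ∈ S) (g : Finset V → ℤ) :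
    ∑ A ∈ S.powerset, g (A.erase x) = 2 * ∑ A ∈ (S.erase x).powerset, g A := by
  rw [← Finset.insert_erase hx, Finset.sum_powerset_insert (Finset.notMem_erase x S),
    Finset.erase_insert (Finset.notMem_erase x S), two_mul]
  congr 1 <;> refine Finset.sum_congr rfl fun A hA => ?_
  all_goals have hxA : x ∉ A := fun h => Finset.notMem_erase x S (Finset.mem_powerset.1 hA h)
  · rw [Finset.erase_eq_of_notMem hxA]
  · rw [Finset.erase_insert hxA]

theorem facetSign_mul_self (L A : Finset V) (x : V) : facetSign L A x * facetSign L A x = 1 := by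
  unfold facetSign
  split_ifs <;> rfl

theorem facetSign_erase {L A : Finset V} {x y : V} (h : y ≠ x) :
    facetSign L (A.erase x) y = facetSign L A y := by
  have hiff : y ∈ A.erase x ↔ y ∈ A := Finset.mem_erase.trans (and_iff_right h)
  classical
  exact if_congr (iff_congr hiff .rfl) rfl rfl

theorem facetSign_initVertex_empty {σ L : Finset V} {x : V} (hx : x ∈ σ \ L) :
    facetSign L (initVertex ∅ σ L) x = 1 := by
  rw [Finset.mem_sdiff] at hx
  simp [facetSign, mem_initVertex, hx]

theorem facetSign_coVertex_empty {σ L : Finset V} {x : V} (hx : x ∈ σ \ L) :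
    facetSign L (coVertex ∅ σ L) x = -1 := by
  rw [Finset.mem_sdiff] at hx
  simp [facetSign, coVertex, mem_initVertex, hx]

theorem sdiff_union_eq_initVertex_iff {U : Set (Finset V)} {σ L A : Finset V} (hA : A ⊆ σ \ L) :
    σ \ (L ∪ A) = initVertex U σ L ↔ A = coVertex U σ L := by
  have hsdiff : ∀ B, σ \ (L ∪ B) = (σ \ L) \ B := fun B => sdiff_sdiff_left.symm
  rw [coVertex, hsdiff, hsdiff]
  constructor
  · intro h
    rw [← h, Finset.sdiff_sdiff_eq_self hA]
  · rintro rfl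
    exact Finset.sdiff_sdiff_eq_self initVertex_subset

section CubicalFormula

variable {c : Finset V → Finset V → Finset V → ℤ} {σ L A : Finset V}

theorem sum_mul_bottom_sub_top (g : Finset V → ℤ) :
    ∑ A ∈ (σ \ L).powerset, g A * ((if A = initVertex ∅ σ L then 1 else 0) -
        if σ \ (L ∪ A) = initVertex ∅ σ L then 1 else 0) =
      g (initVertex ∅ σ L) - g (coVertex ∅ σ L) := by
  have htop : coVertex ∅ σ L ⊆ σ \ L :=
    Finset.sdiff_subset_sdiff subset_rfl Finset.subset_union_left
  have hiff : ∀ A ∈ (σ \ L).powerset,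
      σ \ (L ∪ A) = initVertex ∅ σ L ↔ A = coVertex ∅ σ L := fun A hA =>
    sdiff_union_eq_initVertex_iff (Finset.mem_powerset.1 hA)
  rw [Finset.sum_congr rfl fun A hA => by rw [if_congr (hiff A hA) rfl rfl]]
  simp only [mul_sub, mul_ite, mul_one, mul_zero, Finset.sum_sub_distrib, Finset.sum_ite_eq',
    Finset.mem_powerset, initVertex_subset, htop, if_true]

theorem cubicalFormula_of_forall_ne (hA : A ⊆ σ \ L)
    (h : ∀ A' ⊆ σ \ L, A' ≠ A → CubicalFormula c σ L A') : CubicalFormula c σ L A := by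
  have hleft : ∑ A ∈ (σ \ L).powerset, ∑ x ∈ σ \ L,
      facetSign L A x * cubeCoeff c σ (insert x L) (A.erase x) = 0 := by
    rw [Finset.sum_comm]
    exact Finset.sum_eq_zero fun x hx => sum_facetSign_mul_eq_zero hx _
  have hright := sum_mul_bottom_sub_top (σ := σ) (L := L) 1
  simp only [Pi.one_apply, one_mul, sub_self] at hright
  rw [← Finset.add_sum_erase _ _ (Finset.mem_powerset.2 hA)] at hleft hright
  have hne := Finset.sum_congr rfl fun A' (hA' : A' ∈ (σ \ L).powerset.erase A) =>
    h A' (Finset.mem_powerset.1 (Finset.mem_of_mem_erase hA')) (Finset.ne_of_mem_erase hA')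
  rw [CubicalFormula]
  linarith

theorem sum_cubeCoeff_insert (h : ∀ A ⊆ σ \ L, CubicalFormula c σ L A) {l : V} (hl : l ∈ σ \ L) :
    ∑ A ∈ (σ \ insert l L).powerset, cubeCoeff c σ (insert l L) A = 1 := by
  have hside : ∀ x ∈ σ \ L, x ≠ l → ∑ A ∈ (σ \ L).powerset,
      facetSign L A l * (facetSign L A x * cubeCoeff c σ (insert x L) (A.erase x)) = 0 :=
    fun x hx hxl => by
      rw [← sum_facetSign_mul_eq_zero (L := L) hx fun A =>
        facetSign L A l * cubeCoeff c σ (insert x L) A]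
      refine Finset.sum_congr rfl fun A _ => ?_
      rw [facetSign_erase hxl.symm, mul_left_comm]
  -- Weighted by `facetSign L A l`, the cubes in direction `l` add up, the others still cancel.
  have hsum : ∑ A ∈ (σ \ L).powerset, facetSign L A l * ∑ x ∈ σ \ L,
      facetSign L A x * cubeCoeff c σ (insert x L) (A.erase x) =
      2 * ∑ A ∈ (σ \ insert l L).powerset, cubeCoeff c σ (insert l L) A := by
    simp only [Finset.mul_sum (σ \ L)]
    rw [Finset.sum_comm, Finset.sum_eq_single_of_mem l hl hside]
    simp only [← mul_assoc, facetSign_mul_self, one_mul]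
    rw [sum_powerset_erase hl, Finset.sdiff_insert]
  rw [Finset.sum_congr rfl fun A hA => by rw [h A (Finset.mem_powerset.1 hA)],
    sum_mul_bottom_sub_top (facetSign L · l), facetSign_initVertex_empty hl,
    facetSign_coVertex_empty hl] at hsum
  linarith

end CubicalFormula

/-- The family `c` of coefficients is a local normalised solution of the homotopy formula on the
faces of `σ`. -/
structure IsLocalSolution (c : Finset V → Finset V → Finset V → ℤ) (i : ℕ) (σ : Finset V) :
    Prop where
  subset : ∀ τ ⊆ σ, ∀ X Y, c τ X Y ≠ 0 → X ⊆ τ ∧ Y ⊆ τ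
  formula : ∀ τ ⊆ σ, τ.Nonempty → ∀ X ⊆ τ, X.Nonempty → ∀ Y ⊆ τ, Y.Nonempty →
    CoeffHomotopyFormula c i τ X Y
  normalized : i = 0 → ∀ v ∈ σ, c {v} {v} {v} = 1

namespace IsLocalSolution

variable {c : Finset V → Finset V → Finset V → ℤ} {i : ℕ} {σ τ L A : Finset V}

theorem mono (h : IsLocalSolution c i σ) (hτ : τ ⊆ σ) : IsLocalSolution c i τ where
  subset := fun ρ hρ => h.subset ρ (hρ.trans hτ)
  formula := fun ρ hρ => h.formula ρ (hρ.trans hτ)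
  normalized := fun hi v hv => h.normalized hi v (hτ hv)

theorem formula_singleton_erase (h : IsLocalSolution c 0 σ) {v : V} (hv : v ∈ σ)
    (hne : (σ.erase v).Nonempty) {x : V} (hx : x ∈ σ) :
    ∑ y ∈ σ.erase x, (-1) ^ below {x} y * c σ {y, x} (σ.erase v) +
        (-1) ^ below σ v * c σ {x} σ =
      (-1) ^ below σ v * c (σ.erase v) {x} (σ.erase v) := by
  have hfaces : ∑ w ∈ σ, (-1) ^ below σ w * c (σ.erase w) {x} (σ.erase v) =
      (-1) ^ below σ v * c (σ.erase v) {x} (σ.erase v) := by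
    refine Finset.sum_eq_single_of_mem v hv fun w hw hwv => ?_
    rw [mul_eq_zero]
    refine .inr (not_imp_comm.1 (h.subset _ (Finset.erase_subset _ _) _ _) fun hsub => ?_)
    exact Finset.notMem_erase w σ (hsub.2 (Finset.mem_erase.2 ⟨hwv, hw⟩))
  have hf := h.formula σ subset_rfl ⟨v, hv⟩ {x} (by simpa using hx) (Finset.singleton_nonempty x)
    _ (Finset.erase_subset v σ) hne
  rw [CoeffHomotopyFormula, coproductCoeff_zero_empty (Finset.singleton_nonempty x),
    coproductCoeff_zero_empty hne, hfaces, Finset.sdiff_singleton_eq_erase, Finset.sdiff_erase hv,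
    Finset.sdiff_self, insert_empty_eq, Finset.sum_singleton, below_erase_self,
    Finset.insert_erase hv] at hf
  simpa [sub_eq_zero] using hf

theorem sum_augmentation (h : IsLocalSolution c 0 σ) (hσ : σ.Nonempty) :
    ∑ x ∈ σ, c σ {x} σ = 1 := by
  induction σ using Finset.strongInduction with
  | H σ ih =>
  obtain ⟨v, hv⟩ := hσ
  rcases (σ.erase v).eq_empty_or_nonempty with hempty | hne
  · obtain rfl : σ = {v} := by rw [← Finset.insert_erase hv, hempty, insert_empty_eq]
    simpa using h.normalized rfl v hv
  have hsub : σ.erase v ⊆ σ := Finset.erase_subset _ _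
  have hface : ∑ x ∈ σ, c (σ.erase v) {x} (σ.erase v) = 1 := by
    rw [← ih _ (Finset.erase_ssubset hv) (h.mono hsub) hne]
    refine (Finset.sum_subset hsub fun x _ hx => ?_).symm
    exact not_imp_comm.1 (h.subset _ hsub _ _) fun h' => hx (h'.1 (by simp))
  have hanti : ∑ x ∈ σ, ∑ y ∈ σ.erase x, (-1) ^ below {x} y * c σ {y, x} (σ.erase v) = 0 := by
    refine sum_sum_erase_eq_zero fun x _ y _ hxy => ?_
    rw [Finset.pair_comm]
    rcases lt_or_gt_of_ne hxy with hlt | hlt <;>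
      simp [below, Finset.filter_singleton, hlt, hlt.not_gt]
  have hsum := Finset.sum_congr rfl fun x hx => h.formula_singleton_erase hv hne hx
  rw [Finset.sum_add_distrib, hanti, zero_add, ← Finset.mul_sum, ← Finset.mul_sum, hface] at hsum
  exact mul_left_cancel₀ (pow_ne_zero _ (by simp)) hsum

theorem cubicalFormula_of_nonempty (h : IsLocalSolution c i σ) (hLσ : L ⊆ σ) (hL : L.card = i)
    (hA : A ⊆ σ \ L) (hX : (L ∪ A).Nonempty) (hY : (σ \ A).Nonempty) :
    CubicalFormula c σ L A := by
  have hcube : IsCube L A (σ \ (L ∪ A)) := .of_subset hA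
  have hsub : L ∪ A ⊆ σ := Finset.union_subset hLσ (hA.trans Finset.sdiff_subset)
  have hσ : L ∪ A ∪ σ \ (L ∪ A) = σ := Finset.union_sdiff_of_subset hsub
  have hB : L ∪ σ \ (L ∪ A) = σ \ A := by grind
  refine (coeffHomotopyFormula_iff_cubicalFormula hcube hσ hL hX (hB ▸ hY) fun w hw => ?_).1 <|
    h.formula σ subset_rfl (hX.mono hsub) _ hsub hX _ (hB ▸ Finset.sdiff_subset) (hB ▸ hY)
  refine not_imp_comm.1 (h.subset _ (Finset.erase_subset _ _) _ _) fun h' => ?_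
  have := @h'.1 w
  have := @h'.2 w
  grind

theorem cubicalFormula_empty (h : IsLocalSolution c 0 σ) (hσ : σ.Nonempty) (hA : A ⊆ σ) :
    CubicalFormula c σ ∅ A := by
  have hempty : CubicalFormula c σ ∅ ∅ := by
    have hinit : initVertex ∅ σ (∅ : Finset V) = ∅ := by ext a; simp [mem_initVertex, EvenGap]
    rw [CubicalFormula, hinit, Finset.sdiff_empty, Finset.empty_union, Finset.sdiff_empty,
      if_neg hσ.ne_empty, if_pos rfl, sub_zero, ← h.sum_augmentation hσ]
    refine Finset.sum_congr rfl fun x _ => ?_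
    simp [facetSign, EvenGap, cubeCoeff, signExp, Finset.filter_singleton]
  have hproper : ∀ A' ⊆ σ, A' ≠ σ → CubicalFormula c σ ∅ A' := fun A' hA' hne => by
    rcases A'.eq_empty_or_nonempty with rfl | hA'ne
    · exact hempty
    · exact h.cubicalFormula_of_nonempty (Finset.empty_subset σ) Finset.card_empty (by simpa)
        (by simpa) (Finset.sdiff_nonempty.2 fun hsub => hne (hA'.antisymm hsub))
  by_cases hAσ : A = σ
  · subst hAσ
    exact cubicalFormula_of_forall_ne (by simp) fun A' hA' => hproper A' (by simpa using hA')
  · exact hproper A hA hAσ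

theorem cubicalFormula (h : IsLocalSolution c i σ) (hσ : σ.Nonempty) (hLσ : L ⊆ σ)
    (hL : L.card = i) (hA : A ⊆ σ \ L) : CubicalFormula c σ L A := by
  rcases L.eq_empty_or_nonempty with rfl | hLne
  · obtain rfl : i = 0 := by simpa using hL.symm
    exact h.cubicalFormula_empty hσ (by simpa using hA)
  · exact h.cubicalFormula_of_nonempty hLσ hL hA (hLne.mono Finset.subset_union_left)
      (hLne.mono fun x hx => by have := @hA x; grind)

theorem sum_cubeCoeff (h : IsLocalSolution c i σ) (hLσ : L ⊆ σ) (hL : L.card = i + 1) :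
    ∑ A ∈ (σ \ L).powerset, cubeCoeff c σ L A = 1 := by
  obtain ⟨l, hl⟩ : L.Nonempty := Finset.card_pos.1 (by omega)
  have hcard : (L.erase l).card = i := by rw [Finset.card_erase_of_mem hl, hL, Nat.add_sub_cancel]
  rw [← Finset.insert_erase hl]
  exact sum_cubeCoeff_insert (fun A hA => h.cubicalFormula ⟨l, hLσ hl⟩
    ((Finset.erase_subset _ _).trans hLσ) hcard hA) (by simp [hLσ hl])

end IsLocalSolution

/-! ### Solutions with one term for each generating set -/

/-- The coefficients `c` on `σ` are supported on cubes of dimension `i + 1`, with at most one cube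
for each set of generating vectors. -/
structure IsMinimalAt (c : Finset V → Finset V → Finset V → ℤ) (i : ℕ) (σ : Finset V) : Prop where
  full : ∀ X Y, c σ X Y ≠ 0 → X ∪ Y = σ ∧ (X ∩ Y).card = i + 1
  unique : ∀ X Y X' Y', c σ X Y ≠ 0 → c σ X' Y' ≠ 0 → X ∩ Y = X' ∩ Y' → X = X' ∧ Y = Y'

open Classical in
/-- The initial vertex of the cube with generating vectors `L` in a minimal solution. -/
def cubeVertex (c : Finset V → Finset V → Finset V → ℤ) (σ L : Finset V) : Finset V :=
  (σ \ L).filter fun a => ∃ X Y, c σ X Y ≠ 0 ∧ X ∩ Y = L ∧ a ∈ X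

section CubeVertex

variable {c : Finset V → Finset V → Finset V → ℤ} {i : ℕ} {σ L A X Y : Finset V}

theorem cubeVertex_subset : cubeVertex c σ L ⊆ σ \ L := fun _ ha => by
  simp only [cubeVertex, Finset.mem_filter] at ha
  exact ha.1

theorem union_inter_sdiff (hL : L ⊆ σ) (hA : A ⊆ σ \ L) : (L ∪ A) ∩ (σ \ A) = L := by
  ext a
  have := @hA a
  have := @hL a
  grind

theorem IsMinimalAt.cubeVertex_inter (hm : IsMinimalAt c i σ) (h : c σ X Y ≠ 0) :
    cubeVertex c σ (X ∩ Y) = X \ Y := by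
  ext a
  have haσ : a ∈ σ ↔ a ∈ X ∨ a ∈ Y := by rw [← (hm.full X Y h).1, Finset.mem_union]
  simp only [cubeVertex, Finset.mem_filter, Finset.mem_sdiff, haσ, Finset.mem_inter]
  constructor
  · rintro ⟨haXY, X', Y', h', hinter, haX'⟩
    obtain ⟨rfl, rfl⟩ := hm.unique _ _ _ _ h' h hinter
    tauto
  · rintro ⟨haX, haY⟩
    exact ⟨by tauto, X, Y, h, rfl, haX⟩

theorem IsMinimalAt.cubeCoeff_eq (hm : IsMinimalAt c i σ) (hs : IsLocalSolution c i σ)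
    (hL : L ⊆ σ) (hcard : L.card = i + 1) (hA : A ⊆ σ \ L) :
    cubeCoeff c σ L A = if A = cubeVertex c σ L then 1 else 0 := by
  have hzero : ∀ A ⊆ σ \ L, A ≠ cubeVertex c σ L → cubeCoeff c σ L A = 0 := fun A hA hne => by
    by_contra h
    have hvertex := hm.cubeVertex_inter (right_ne_zero_of_mul h)
    rw [union_inter_sdiff hL hA] at hvertex
    refine hne (hvertex.symm ▸ ?_)
    ext a
    have := @hA a
    grind
  split_ifs with h
  · rw [h, ← hs.sum_cubeCoeff hL hcard]
    exact (Finset.sum_eq_single_of_mem _ (Finset.mem_powerset.2 cubeVertex_subset)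
      fun A hA => hzero A (Finset.mem_powerset.1 hA)).symm
  · exact hzero A hA h

theorem IsLocalSolution.exists_inter_eq (hs : IsLocalSolution c i σ) (hL : L ⊆ σ)
    (hcard : L.card = i + 1) : ∃ X Y, c σ X Y ≠ 0 ∧ X ∪ Y = σ ∧ X ∩ Y = L := by
  obtain ⟨A, hA, h⟩ := Finset.exists_ne_zero_of_sum_ne_zero
    ((hs.sum_cubeCoeff hL hcard).trans_ne one_ne_zero)
  rw [Finset.mem_powerset] at hA
  have hAσ : L ∪ A ⊆ σ := Finset.union_subset hL (hA.trans Finset.sdiff_subset)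
  exact ⟨L ∪ A, σ \ A, right_ne_zero_of_mul h, by grind, union_inter_sdiff hL hA⟩

theorem IsLocalSolution.coeff_insert_ne_zero (hs : IsLocalSolution c i σ)
    (hm : IsMinimalAt c i σ) {w : V} (hw : w ∈ σ) (hunion : X ∪ Y = σ.erase w)
    (hX : X.Nonempty) (hY : Y.Nonempty) (h : c (σ.erase w) X Y ≠ 0) :
    c σ (insert w X) Y ≠ 0 ∨ c σ X (insert w Y) ≠ 0 := by
  by_contra! hzero
  have hXYσ : X ∪ Y ⊆ σ := hunion.subset.trans (Finset.erase_subset w σ)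
  have hXσ : X ⊆ σ := Finset.subset_union_left.trans hXYσ
  have hYσ : Y ⊆ σ := Finset.subset_union_right.trans hXYσ
  have hleft : ∀ x ∈ σ \ X, (-1) ^ below X x * c σ (insert x X) Y = 0 := fun x hx => by
    rw [mul_eq_zero]
    refine .inr (by_contra fun hne => ?_)
    obtain rfl | hxw := eq_or_ne x w
    · exact hne hzero.1
    · have := (hm.full _ _ hne).1
      grind
  have hright : ∀ y ∈ σ \ Y, (-1) ^ below Y y * c σ X (insert y Y) = 0 := fun y hy => by
    rw [mul_eq_zero]
    refine .inr (by_contra fun hne => ?_)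
    obtain rfl | hyw := eq_or_ne y w
    · exact hne hzero.2
    · have := (hm.full _ _ hne).1
      grind
  have hface : ∀ v ∈ σ, v ≠ w → (-1) ^ below σ v * c (σ.erase v) X Y = 0 := fun v hv hvw => by
    rw [mul_eq_zero]
    refine .inr (by_contra fun hne => ?_)
    have hsub := hs.subset _ (Finset.erase_subset v σ) _ _ hne
    exact Finset.notMem_erase v σ (Finset.union_subset hsub.1 hsub.2 (by grind))
  have hf := hs.formula σ subset_rfl ⟨w, hw⟩ X hXσ hX Y hYσ hY
  have hne : X ∪ Y ≠ σ := by grind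
  rw [CoeffHomotopyFormula, Finset.sum_eq_zero hleft, Finset.sum_eq_zero hright,
    Finset.sum_eq_single_of_mem w hw hface, coproductCoeff_eq_zero_of_union_ne hne,
    coproductCoeff_eq_zero_of_union_ne (Finset.union_comm X Y ▸ hne)] at hf
  simp [h] at hf

theorem cubeVertex_erase (hs : IsLocalSolution c i σ) (hm : IsMinimalAt c i σ) {w : V}
    (hm' : IsMinimalAt c i (σ.erase w)) (hw : w ∈ σ) (hL : L ⊆ σ.erase w)
    (hcard : L.card = i + 1) :
    (cubeVertex c σ L).erase w = cubeVertex c (σ.erase w) L := by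
  obtain ⟨X, Y, hc, hunion, rfl⟩ :=
    (hs.mono (Finset.erase_subset w σ)).exists_inter_eq hL hcard
  have hne : (X ∩ Y).Nonempty := Finset.card_pos.1 (by omega)
  have hwXY : w ∉ X ∪ Y := hunion ▸ Finset.notMem_erase w σ
  rw [Finset.mem_union, not_or] at hwXY
  rw [hm'.cubeVertex_inter hc]
  rcases hs.coeff_insert_ne_zero hm hw hunion (hne.mono Finset.inter_subset_left)
    (hne.mono Finset.inter_subset_right) hc with h | h
  · rw [← Finset.insert_inter_of_notMem hwXY.2, hm.cubeVertex_inter h]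
    grind
  · rw [← Finset.inter_insert_of_notMem hwXY.1, hm.cubeVertex_inter h]
    grind

theorem mem_cubeVertex_iff (hs : IsLocalSolution c i σ) (hm : ∀ τ ⊆ σ, IsMinimalAt c i τ)
    (hL : L ⊆ σ) (hcard : L.card = i + 1) {a : V} (ha : a ∈ σ) :
    a ∈ cubeVertex c σ L ↔ a ∈ cubeVertex c (insert a L) L := by
  induction σ using Finset.strongInduction with
  | H σ ih =>
  by_cases heq : insert a L = σ
  · rw [heq]
  obtain ⟨w, hw, hw'⟩ :=
    Finset.exists_of_ssubset ((Finset.insert_subset ha hL).ssubset_of_ne heq)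
  rw [Finset.mem_insert, not_or] at hw'
  have hτ := Finset.erase_subset w σ
  have hLw : L ⊆ σ.erase w := Finset.subset_erase.2 ⟨hL, hw'.2⟩
  rw [← ih _ (Finset.erase_ssubset hw) (hs.mono hτ) (fun ρ hρ => hm ρ (hρ.trans hτ)) hLw
    (Finset.mem_erase.2 ⟨Ne.symm hw'.1, ha⟩),
    ← cubeVertex_erase hs (hm σ subset_rfl) (hm _ hτ) hw hLw hcard, Finset.mem_erase]
  exact (and_iff_right (Ne.symm hw'.1)).symm

theorem initVertex_empty_ne_coVertex (hne : (σ \ L).Nonempty) :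
    initVertex ∅ σ L ≠ coVertex ∅ σ L := fun h => by
  obtain ⟨x, hx⟩ := hne
  have hbottom := facetSign_initVertex_empty hx
  rw [h, facetSign_coVertex_empty hx] at hbottom
  norm_num at hbottom

theorem exists_erase_eq_cubeVertex (hs : IsLocalSolution c i σ) (hm : IsMinimalAt c i σ)
    (hL : L ⊆ σ) (hcard : L.card = i) (hne : (σ \ L).Nonempty) (hA : A ⊆ σ \ L)
    (hA' : A = initVertex ∅ σ L ∨ A = coVertex ∅ σ L) :
    ∃ x ∈ σ \ L, A.erase x = cubeVertex c σ (insert x L) := by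
  classical
  by_contra! hno
  have hf := hs.cubicalFormula (hne.mono Finset.sdiff_subset) hL hcard hA
  have hzero : ∀ x ∈ σ \ L, facetSign L A x * cubeCoeff c σ (insert x L) (A.erase x) = 0 :=
    fun x hx => by
      obtain ⟨hxσ, hxL⟩ := Finset.mem_sdiff.1 hx
      rw [hm.cubeCoeff_eq hs (Finset.insert_subset hxσ hL)
        (by rw [Finset.card_insert_of_notMem hxL, hcard]), if_neg (hno x hx), mul_zero]
      intro a ha
      have := @hA a
      grind
  rw [CubicalFormula, Finset.sum_eq_zero hzero,
    if_congr (sdiff_union_eq_initVertex_iff hA) rfl rfl] at hf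
  have hbt := initVertex_empty_ne_coVertex hne
  rcases hA' with rfl | rfl
  · simp [hbt] at hf
  · simp [hbt.symm] at hf

end CubeVertex

section InversionSet

variable {c : Finset V → Finset V → Finset V → ℤ} {i : ℕ} {σ L M X Y : Finset V}

/-- The set of inversions of a minimal solution: the simplices `M` with `i + 2` vertices in a family
`F` on which the cubes of the solution are not those of the coproduct with `U = ∅`; by
`cubeVertex_evenGap_iff` this can be read off from any of these cubes. -/
def inversionSet (c : Finset V → Finset V → Finset V → ℤ) (F : Set (Finset V)) (i : ℕ) :
    Set (Finset V) :=
  {M | M ∈ F ∧ M.card = i + 2 ∧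
    ∃ a ∈ M, (a ∈ cubeVertex c M (M.erase a) ↔ EvenGap (M.erase a) a)}

theorem mem_erase_initVertex_iff {x z : V} (hx : x ∉ L) (hz : z ∈ σ \ L) (hzx : z ≠ x) :
    (z ∈ (initVertex ∅ σ L).erase x ↔ EvenGap (insert x L) z) ↔ z < x := by
  rw [Finset.mem_sdiff] at hz
  simp only [Finset.mem_erase, mem_initVertex, hz, hzx, evenGap_insert hx,
    Set.mem_empty_iff_false, ne_eq, not_false_eq_true, and_self, true_and, false_iff]
  tauto

theorem mem_erase_coVertex_iff {x z : V} (hx : x ∉ L) (hz : z ∈ σ \ L) (hzx : z ≠ x) :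
    (z ∈ (coVertex ∅ σ L).erase x ↔ EvenGap (insert x L) z) ↔ x < z := by
  rw [← not_lt.trans hzx.symm.le_iff_lt, ← mem_erase_initVertex_iff hx hz hzx]
  rw [Finset.mem_sdiff] at hz
  simp only [Finset.mem_erase, coVertex, Finset.mem_sdiff, Finset.mem_union, hz, hzx, ne_eq,
    not_false_eq_true, true_and, false_or]
  tauto

theorem cubeVertex_insert_evenGap_iff {a b : V} (hs : IsLocalSolution c i (insert a (insert b L)))
    (hm : IsMinimalAt c i (insert a (insert b L))) (hL : L.card = i) (ha : a ∉ L) (hb : b ∉ L)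
    (hab : a ≠ b) :
    (a ∈ cubeVertex c (insert a (insert b L)) (insert b L) ↔ EvenGap (insert b L) a) ↔
      (b ∈ cubeVertex c (insert a (insert b L)) (insert a L) ↔ EvenGap (insert a L) b) := by
  set M := insert a (insert b L) with hM
  have hmem : ∀ z, z ∈ M \ L ↔ z = a ∨ z = b := by grind
  have hne : (M \ L).Nonempty := ⟨a, by grind⟩
  have hLM : L ⊆ M := by grind
  -- The cubes of the solution form a path from the bottom to the top, first in direction `x`.
  obtain ⟨x, hx, hxO⟩ := exists_erase_eq_cubeVertex hs hm hLM hL hne initVertex_subset (.inl rfl)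
  obtain ⟨y, hy, hyO⟩ := exists_erase_eq_cubeVertex hs hm hLM hL hne
    (Finset.sdiff_subset_sdiff subset_rfl Finset.subset_union_left) (.inr rfl)
  have hxL := (Finset.mem_sdiff.1 hx).2
  have hyL := (Finset.mem_sdiff.1 hy).2
  have hfirst : ∀ z ∈ M \ L, z ≠ x →
      ((z ∈ cubeVertex c M (insert x L) ↔ EvenGap (insert x L) z) ↔ z < x) := fun z hz hzx =>
    hxO ▸ mem_erase_initVertex_iff hxL hz hzx
  have hlast : ∀ z ∈ M \ L, z ≠ y →
      ((z ∈ cubeVertex c M (insert y L) ↔ EvenGap (insert y L) z) ↔ y < z) := fun z hz hzy =>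
    hyO ▸ mem_erase_coVertex_iff hyL hz hzy
  have hxy : x ≠ y := by
    rintro rfl
    obtain ⟨z, hz, hzx⟩ : ∃ z ∈ M \ L, z ≠ x := by
      rcases (hmem x).1 hx with rfl | rfl
      · exact ⟨b, (hmem b).2 (.inr rfl), hab.symm⟩
      · exact ⟨a, (hmem a).2 (.inl rfl), hab⟩
    have hiff := (hfirst z hz hzx).symm.trans (hlast z hz hzx)
    exact hzx.lt_or_gt.elim (fun h => h.not_gt (hiff.1 h)) fun h => h.not_gt (hiff.2 h)
  have hiff := (hfirst y hy hxy.symm).trans (hlast x hx hxy).symm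
  rcases (hmem x).1 hx with rfl | rfl <;> rcases (hmem y).1 hy with rfl | rfl
  · exact absurd rfl hxy
  · exact hiff.symm
  · exact hiff
  · exact absurd rfl hxy

theorem cubeVertex_evenGap_iff (hs : IsLocalSolution c i M) (hm : IsMinimalAt c i M)
    (hM : M.card = i + 2) {a b : V} (ha : a ∈ M) (hb : b ∈ M) :
    (a ∈ cubeVertex c M (M.erase a) ↔ EvenGap (M.erase a) a) ↔
      (b ∈ cubeVertex c M (M.erase b) ↔ EvenGap (M.erase b) b) := by
  obtain rfl | hab := eq_or_ne a b
  · rfl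
  have hba : b ∈ M.erase a := Finset.mem_erase.2 ⟨hab.symm, hb⟩
  have hcard : ((M.erase a).erase b).card = i := by
    rw [Finset.card_erase_of_mem hba, Finset.card_erase_of_mem ha]
    omega
  have ha' : insert a (insert b ((M.erase a).erase b)) = M := by
    rw [Finset.insert_erase hba, Finset.insert_erase ha]
  have hb' : insert a ((M.erase a).erase b) = M.erase b := by grind
  have key := cubeVertex_insert_evenGap_iff (ha'.symm ▸ hs) (ha'.symm ▸ hm) hcard (by simp)
    (by simp) hab
  rwa [ha', hb', Finset.insert_erase hba] at key

variable {F : Set (Finset V)}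

theorem insert_mem_inversionSet_iff {a : V} (ha : a ∉ L) (hF : insert a L ∈ F)
    (hs : IsLocalSolution c i (insert a L)) (hm : IsMinimalAt c i (insert a L))
    (hcard : L.card = i + 1) :
    insert a L ∈ inversionSet c F i ↔ (a ∈ cubeVertex c (insert a L) L ↔ EvenGap L a) := by
  have hM : (insert a L).card = i + 2 := by rw [Finset.card_insert_of_notMem ha, hcard]
  constructor
  · rintro ⟨-, -, b, hb, h⟩
    rwa [cubeVertex_evenGap_iff hs hm hM hb (Finset.mem_insert_self a L),
      Finset.erase_insert ha] at h
  · intro h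
    exact ⟨hF, hM, a, Finset.mem_insert_self _ _, by rwa [Finset.erase_insert ha]⟩

theorem cubeVertex_eq_initVertex (hF : ∀ M ⊆ σ, M.Nonempty → M ∈ F)
    (hs : IsLocalSolution c i σ) (hm : ∀ τ ⊆ σ, IsMinimalAt c i τ) (hL : L ⊆ σ)
    (hcard : L.card = i + 1) : cubeVertex c σ L = initVertex (inversionSet c F i) σ L := by
  ext a
  by_cases ha : a ∈ σ \ L
  · obtain ⟨haσ, haL⟩ := Finset.mem_sdiff.1 ha
    have hsub : insert a L ⊆ σ := Finset.insert_subset haσ hL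
    rw [mem_initVertex, mem_cubeVertex_iff hs hm hL hcard haσ, insert_mem_inversionSet_iff haL
      (hF _ hsub (Finset.insert_nonempty _ _)) (hs.mono hsub) (hm _ hsub) hcard]
    tauto
  · exact iff_of_false (fun h => ha (cubeVertex_subset h)) fun h => ha (initVertex_subset h)

theorem exists_not_precedes (hF : ∀ M ⊆ σ, M.Nonempty → M ∈ F)
    (hs : IsLocalSolution c i σ) (hm : ∀ τ ⊆ σ, IsMinimalAt c i τ) (hL : L ⊆ σ)
    (hcard : L.card = i) (hne : (σ \ L).Nonempty) :
    ∃ x ∈ σ \ L, ∀ y ∈ σ \ L, ¬ Precedes (inversionSet c F i) L y x := by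
  classical
  obtain ⟨x, hx, h⟩ := exists_erase_eq_cubeVertex hs (hm σ subset_rfl) hL hcard hne
    initVertex_subset (.inl rfl)
  obtain ⟨hxσ, hxL⟩ := Finset.mem_sdiff.1 hx
  rw [cubeVertex_eq_initVertex hF hs hm (Finset.insert_subset hxσ hL)
      (by rw [Finset.card_insert_of_notMem hxL, hcard]),
    erase_eq_initVertex_iff initVertex_subset hxL,
    (facetCoord_eq_empty initVertex_subset).2 rfl, Finset.erase_empty, eq_comm,
    Finset.filter_eq_empty_iff] at h
  exact ⟨x, hx, h⟩

theorem consistentAt_of_forall_lt_lt {U : Set (Finset V)}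
    (h : ∀ x ∈ M, ∀ y ∈ M, ∀ z ∈ M, x < y → y < z → (M.erase x ∈ U ↔ M.erase z ∈ U) →
      (M.erase x ∈ U ↔ M.erase y ∈ U)) : ConsistentAt U M := by
  let f : M → Prop := fun k => M.erase k ∈ U
  have hf : Monotone f ∨ Antitone f := by
    by_contra! hf
    obtain ⟨x, y, z, hxy, hyz, hf⟩ := not_monotone_not_antitone_iff_exists_lt_lt.1 hf
    have := h x x.2 y y.2 z z.2 hxy hyz
    simp only [f, lt_iff_le_not_ge, le_Prop_eq] at hf
    tauto
  exact hf.imp (fun hf k hk k' hk' hlt => hf (a := ⟨k, hk⟩) (b := ⟨k', hk'⟩) hlt.le)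
    fun hf k hk k' hk' hlt => hf (a := ⟨k, hk⟩) (b := ⟨k', hk'⟩) hlt.le

theorem consistentAt_of_exists_not_precedes {U : Set (Finset V)}
    (h : ∀ L ⊆ M, M.card = L.card + 3 →
      ∃ x ∈ M \ L, ∀ y ∈ M \ L, ¬ Precedes U L y x) : ConsistentAt U M := by
  refine consistentAt_of_forall_lt_lt fun x hx y hy z hz hxy hyz hxz => ?_
  have hcard : ({x, y, z} : Finset V).card = 3 :=
    Finset.card_eq_three.2 ⟨x, y, z, hxy.ne, (hxy.trans hyz).ne, hyz.ne, rfl⟩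
  have hsub : {x, y, z} ⊆ M := by grind
  set L := M \ {x, y, z} with hL
  obtain ⟨w, hw, hmin⟩ := h L Finset.sdiff_subset <| by
    rw [← hcard, hL, Finset.card_sdiff_add_card_eq_card hsub]
  have hx' : M.erase x = insert y (insert z L) := by grind
  have hy' : M.erase y = insert z (insert x L) := by grind
  have hz' : M.erase z = insert x (insert y L) := by grind
  have hxyz : w = x ∨ w = y ∨ w = z := by grind
  have hyx := Finset.insert_comm y x L
  have hzx := Finset.insert_comm z x L
  have hzy := Finset.insert_comm z y L
  have hminx := hmin x (by grind)
  have hminy := hmin y (by grind)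
  have hminz := hmin z (by grind)
  rw [hx', hz'] at hxz
  rw [hx', hy']
  simp only [Precedes, ne_eq, not_and, hzx] at hminx hminy hminz hxz ⊢
  clear h hmin
  rcases hxyz with rfl | rfl | rfl <;> grind

theorem consistentAt_inversionSet (hF : ∀ M' ⊆ M, M'.Nonempty → M' ∈ F)
    (hs : IsLocalSolution c i M) (hm : ∀ τ ⊆ M, IsMinimalAt c i τ) (hM : M.card = i + 3) :
    ConsistentAt (inversionSet c F i) M :=
  consistentAt_of_exists_not_precedes fun L hL hcard =>
    exists_not_precedes hF hs hm hL (by omega) <| Finset.card_pos.1 <| by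
      rw [Finset.card_sdiff_of_subset hL]
      omega

theorem eq_coproductCoeff_inversionSet (hF : ∀ M ⊆ σ, M.Nonempty → M ∈ F)
    (hs : IsLocalSolution c i σ) (hm : ∀ τ ⊆ σ, IsMinimalAt c i τ) (X Y : Finset V) :
    c σ X Y = coproductCoeff (i + 1) (inversionSet c F i) σ X Y := by
  by_cases hXY : X ∪ Y = σ ∧ (X ∩ Y).card = i + 1
  · obtain ⟨rfl, hcard⟩ := hXY
    have hL : X ∩ Y ⊆ X ∪ Y := by grind
    have hcube := (hm _ subset_rfl).cubeCoeff_eq hs hL hcard (A := X \ Y) (by grind)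
    have hX : X ∩ Y ∪ X \ Y = X := by grind
    have hY : (X ∪ Y) \ (X \ Y) = Y := by grind
    have hB : (X ∪ Y) \ X = Y \ X := by grind
    rw [cubeCoeff, hX, hY, hB, cubeVertex_eq_initVertex hF hs hm hL hcard] at hcube
    rw [coproductCoeff, ← neg_one_pow_mul_cancel (signExp (X ∪ Y).card (X ∩ Y) (X \ Y) (Y \ X))
      (c _ X Y), hcube]
    simp only [hcard, true_and, mul_ite, mul_one, mul_zero]
  · rw [coproductCoeff, if_neg fun h => hXY ⟨h.1, h.2.1⟩]
    exact not_imp_comm.1 ((hm σ subset_rfl).full X Y) hXY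

end InversionSet

/-! ### The retraction onto a simplex -/

theorem below_insert_add_below_insert {s : Finset V} {x y : V} (hx : x ∉ s) (hy : y ∉ s)
    (hxy : x ≠ y) :
    below (insert x s) y + below (insert y s) x = below s x + below s y + 1 := by
  rw [below_insert hx, below_insert hy]
  rcases hxy.lt_or_gt with h | h <;> simp only [h, h.not_gt, if_true, if_false] <;> ring

theorem neg_one_pow_below_erase {s : Finset V} {x y : V} (hx : x ∈ s) (hy : y ∈ s) (hxy : x ≠ y) :
    (-1 : ℤ) ^ below s x * (-1) ^ below (s.erase x) y =
      -((-1) ^ below s y * (-1) ^ below (s.erase y) x) := by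
  obtain ⟨t, hxt, hyt, rfl⟩ : ∃ t, x ∉ t ∧ y ∉ t ∧ s = insert x (insert y t) :=
    ⟨(s.erase x).erase y, by simp, by simp, by grind⟩
  have h := below_insert_add_below_insert hxt hyt hxy
  rw [below_insert_self, Finset.erase_insert (by simp [hxy, hxt]), below_insert_self,
    Finset.insert_comm, below_insert_self, Finset.erase_insert (by simp [hxy.symm, hyt]),
    below_insert_self, ← pow_add, ← pow_add]
  calc (-1 : ℤ) ^ (below (insert y t) x + below t y)
      = (-1) ^ (below (insert x t) y + below t x + 1) := neg_one_pow_congr (by grind)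
    _ = -(-1) ^ (below (insert x t) y + below t x) := (pow_succ' _ _).trans (neg_one_mul _)

section Retraction

variable {K : PreAbstractSimplicialComplex V} {σ s t : Finset V} {w : V}

theorem boundary_boundary (a : Chains K) : boundary K (boundary K a) = 0 := by
  suffices h : boundary K ∘ₗ boundary K = 0 from LinearMap.congr_fun h a
  refine linearMap_ext fun s hs => ?_
  have hface : ∀ x ∈ s, boundary K (chain K (s.erase x)) =
      ∑ y ∈ s.erase x, (-1 : ℤ) ^ below (s.erase x) y • chain K ((s.erase x).erase y) :=
    fun x _ => by
      rcases (s.erase x).eq_empty_or_nonempty with h | h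
      · simp [h, chain_empty]
      · exact boundary_chain (mem_faces_of_subset hs (Finset.erase_subset x s) h)
  rw [LinearMap.comp_apply, boundary_chain hs, map_sum]
  simp only [map_zsmul, LinearMap.zero_apply]
  rw [Finset.sum_congr rfl fun x hx => by rw [hface x hx, Finset.smul_sum]]
  refine sum_sum_erase_eq_zero fun x hx y hy hxy => ?_
  rw [smul_smul, smul_smul, neg_one_pow_below_erase hx hy hxy, Finset.erase_right_comm, neg_smul]

theorem augmentation_boundary (a : Chains K) : augmentation K (boundary K a) = 0 := by
  suffices h : augmentation K ∘ₗ boundary K = 0 from LinearMap.congr_fun h a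
  refine linearMap_ext fun s hs => ?_
  have hface : ∀ x ∈ s, augmentation K (chain K (s.erase x)) = if s.card = 2 then 1 else 0 :=
    fun x hx => by
      have hcard := Finset.card_erase_add_one hx
      rcases (s.erase x).eq_empty_or_nonempty with h | h
      · rw [h, Finset.card_empty] at hcard
        rw [h, chain_empty, map_zero, if_neg (by omega)]
      · rw [augmentation_chain (mem_faces_of_subset hs (Finset.erase_subset x s) h)]
        exact if_congr (by omega) rfl rfl
  rw [LinearMap.comp_apply, boundary_chain hs, map_sum, LinearMap.zero_apply]
  simp only [map_zsmul]
  rw [Finset.sum_congr rfl fun x hx => by rw [hface x hx]]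
  split_ifs with hcard
  · obtain ⟨x, y, hxy, rfl⟩ := Finset.card_eq_two.1 hcard
    rw [Finset.sum_pair hxy]
    rcases lt_or_gt_of_ne hxy with h | h <;>
      simp [below, Finset.filter_insert, Finset.filter_singleton, h, h.not_gt]
  · simp

/-- The cone with apex `w` over `t`, zero if `t` is not a subset of `σ` or contains `w`. The cone
over the empty set is the vertex `w`. -/
def coneChain (K : PreAbstractSimplicialComplex V) (σ : Finset V) (w : V) (t : Finset V) :
    Chains K :=
  if t ⊆ σ ∧ w ∉ t then (-1 : ℤ) ^ below t w • chain K (insert w t) else 0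

/-- The linear extension of `coneChain`. -/
def cone (K : PreAbstractSimplicialComplex V) (σ : Finset V) (w : V) : Chains K →ₗ[ℤ] Chains K :=
  Finsupp.linearCombination ℤ fun τ : K.faces => coneChain K σ w τ.1

theorem cone_chain (hs : s ∈ K.faces) : cone K σ w (chain K s) = coneChain K σ w s := by
  rw [chain_of_mem hs, cone, Finsupp.linearCombination_single, one_smul]

/-- The chain map of the simplicial retraction onto `σ` that sends all vertices outside `σ` to the
vertex `w` of `σ`, written as a sum of maps that visibly commutes with the boundary. -/
def retraction (K : PreAbstractSimplicialComplex V) (σ : Finset V) (w : V) :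
    Chains K →ₗ[ℤ] Chains K :=
  boundary K ∘ₗ cone K σ w + cone K σ w ∘ₗ boundary K +
    (augmentation K).smulRight (chain K {w})

theorem retraction_apply (a : Chains K) :
    retraction K σ w a = boundary K (cone K σ w a) + cone K σ w (boundary K a) +
      augmentation K a • chain K {w} := rfl

theorem boundary_chain_singleton (v : V) : boundary K (chain K {v}) = 0 := by
  by_cases hv : {v} ∈ K.faces
  · simp [boundary_chain hv, chain_empty]
  · rw [chain_of_notMem hv, map_zero]

theorem boundary_retraction (a : Chains K) :
    boundary K (retraction K σ w a) = retraction K σ w (boundary K a) := by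
  simp only [retraction_apply, map_add, map_smul, boundary_boundary, augmentation_boundary,
    boundary_chain_singleton, map_zero, smul_zero, zero_smul, add_zero, zero_add]

-- The augmentation accounts for the cone over the empty face of a vertex.
theorem retraction_chain (hs : s ∈ K.faces) :
    retraction K σ w (chain K s) = boundary K (coneChain K σ w s) +
      ∑ v ∈ s, (-1 : ℤ) ^ below s v • coneChain K σ w (s.erase v) := by
  rw [retraction_apply, cone_chain hs, add_assoc, augmentation_chain hs, boundary_chain hs,
    map_sum]
  congr 1
  by_cases hcard : s.card = 1
  · obtain ⟨v, rfl⟩ := Finset.card_eq_one.1 hcard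
    simp [chain_empty, coneChain, below, Finset.filter_singleton]
  · rw [if_neg hcard, zero_smul, add_zero]
    refine Finset.sum_congr rfl fun v hv => ?_
    have hne : (s.erase v).Nonempty := by
      have := Finset.card_erase_add_one hv
      exact Finset.card_pos.1 (by omega)
    rw [map_zsmul, cone_chain (mem_faces_of_subset hs (Finset.erase_subset v s) hne)]

theorem retraction_chain_of_subset (hσ : σ ∈ K.faces) (hw : w ∈ σ) (h : s ⊆ σ) :
    retraction K σ w (chain K s) = chain K s := by
  by_cases hs : s ∈ K.faces
  swap
  · rw [chain_of_notMem hs, map_zero]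
  have herase : ∀ v, s.erase v ⊆ σ := fun v => (Finset.erase_subset v s).trans h
  rw [retraction_chain hs]
  by_cases hws : w ∈ s
  · have hcone : ∀ t, w ∈ t → coneChain K σ w t = 0 := fun t ht => if_neg fun h => h.2 ht
    rw [hcone s hws, map_zero, zero_add, Finset.sum_eq_single_of_mem w hws fun v _ hvw => by
      rw [hcone _ (Finset.mem_erase.2 ⟨hvw.symm, hws⟩), smul_zero], coneChain,
      if_pos ⟨herase w, Finset.notMem_erase w s⟩, Finset.insert_erase hws, below_erase_self,
      smul_smul, neg_one_pow_mul_self, one_smul]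
  · have hcancel : ∀ v ∈ s, (-1 : ℤ) ^ below s w • (-1 : ℤ) ^ below (insert w s) v •
          chain K ((insert w s).erase v) + (-1 : ℤ) ^ below s v • coneChain K σ w (s.erase v) = 0 :=
      fun v hv => by
        have hvw : v ≠ w := ne_of_mem_of_not_mem hv hws
        have hsum := below_insert_add_below_insert (Finset.notMem_erase v s)
          (fun hw => hws (Finset.mem_of_mem_erase hw)) hvw
        have hsign : (-1 : ℤ) ^ below s w * (-1) ^ below (insert w s) v =
            -((-1) ^ below s v * (-1) ^ below (s.erase v) w) := by
          rw [Finset.insert_erase hv, below_erase_self, ← Finset.erase_insert_of_ne hvw.symm,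
            below_erase_self] at hsum
          rw [← pow_add, hsum, pow_succ, mul_neg_one, pow_add]
        rw [coneChain, if_pos ⟨herase v, fun hw => hws (Finset.mem_of_mem_erase hw)⟩,
          Finset.erase_insert_of_ne hvw.symm, smul_smul, smul_smul, hsign, neg_smul,
          neg_add_cancel]
    rw [coneChain, if_pos ⟨h, hws⟩, map_zsmul, boundary_chain (mem_faces_of_subset hσ
      (Finset.insert_subset hw h) (Finset.insert_nonempty w s)), Finset.sum_insert hws,
      Finset.erase_insert hws, below_insert_self, smul_add, smul_smul, neg_one_pow_mul_self,
      one_smul, Finset.smul_sum, add_assoc, ← Finset.sum_add_distrib,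
      Finset.sum_eq_zero hcancel, add_zero]

/-- The retraction of the vertices onto `σ` that sends all vertices outside `σ` to `w`. -/
def vertexRetraction (σ : Finset V) (w v : V) : V := if v ∈ σ then v else w

theorem image_vertexRetraction_of_subset (h : s ⊆ σ) : s.image (vertexRetraction σ w) = s :=
  (Finset.image_congr fun _ hv => if_pos (h hv)).trans Finset.image_id

theorem eq_insert_of_chainCoeff_coneChain_ne_zero (h : chainCoeff K t (coneChain K σ w s) ≠ 0) :
    s ⊆ σ ∧ w ∉ s ∧ t = insert w s := by
  rw [coneChain] at h
  split_ifs at h with hs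
  · refine ⟨hs.1, hs.2, ?_⟩
    rw [map_smul] at h
    by_cases hws : insert w s ∈ K.faces
    · rw [chainCoeff_chain hws] at h
      by_contra hne
      simp [hne] at h
    · simp [chain_of_notMem hws] at h
  · exact absurd (map_zero _) h

theorem eq_image_of_chainCoeff_retraction_ne_zero (hσ : σ ∈ K.faces) (hw : w ∈ σ)
    (hs : s ∈ K.faces) (h : chainCoeff K t (retraction K σ w (chain K s)) ≠ 0) :
    t ⊆ σ ∧ t = s.image (vertexRetraction σ w) ∧ t.card = s.card := by
  by_cases hsσ : s ⊆ σ
  · rw [retraction_chain_of_subset hσ hw hsσ, chainCoeff_chain hs] at h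
    obtain rfl : t = s := by simpa using h
    exact ⟨hsσ, (image_vertexRetraction_of_subset hsσ).symm, rfl⟩
  · rw [retraction_chain hs, coneChain, if_neg fun h => hsσ h.1, map_zero, zero_add, map_sum] at h
    obtain ⟨v, hv, hterm⟩ := Finset.exists_ne_zero_of_sum_ne_zero h
    rw [map_zsmul] at hterm
    obtain ⟨hsub, hws, rfl⟩ :=
      eq_insert_of_chainCoeff_coneChain_ne_zero (right_ne_zero_of_smul hterm)
    have hvσ : v ∉ σ := fun hvσ => hsσ (Finset.insert_erase hv ▸ Finset.insert_subset hvσ hsub)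
    refine ⟨Finset.insert_subset hw hsub, ?_, ?_⟩
    · conv_rhs => rw [← Finset.insert_erase hv, Finset.image_insert,
        image_vertexRetraction_of_subset hsub, vertexRetraction, if_neg hvσ]
    · rw [Finset.card_insert_of_notMem hws, Finset.card_erase_add_one hv]

theorem signMap_retraction (hσ : σ ∈ K.faces) (hw : w ∈ σ) (a : Chains K) :
    signMap K (retraction K σ w a) = retraction K σ w (signMap K a) := by
  suffices h : signMap K ∘ₗ retraction K σ w = retraction K σ w ∘ₗ signMap K from
    LinearMap.congr_fun h a
  refine linearMap_ext fun s hs => chains_ext fun t _ => ?_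
  rw [LinearMap.comp_apply, LinearMap.comp_apply, signMap_chain, map_zsmul, chainCoeff_signMap,
    map_zsmul, smul_eq_mul]
  by_cases h : chainCoeff K t (retraction K σ w (chain K s)) = 0
  · rw [h, mul_zero, mul_zero]
  · rw [(eq_image_of_chainCoeff_retraction_ne_zero hσ hw hs h).2.2]

end Retraction

/-! ### Solutions with few terms are local -/

section Locality

variable {K : PreAbstractSimplicialComplex V} {i : ℕ} {σ τ X Y : Finset V} {w : V}
  {z : Chains K ⊗[ℤ] Chains K} {D : Chains K →ₗ[ℤ] Chains K ⊗[ℤ] Chains K}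

/-- The tensor square of the retraction onto `σ`. -/
def tensorRetraction (K : PreAbstractSimplicialComplex V) (σ : Finset V) (w : V) :
    Chains K ⊗[ℤ] Chains K →+ Chains K ⊗[ℤ] Chains K :=
  (TensorProduct.map (retraction K σ w) (retraction K σ w)).toAddMonoidHom

theorem tensorRetraction_tmul (a b : Chains K) :
    tensorRetraction K σ w (a ⊗ₜ[ℤ] b) = retraction K σ w a ⊗ₜ[ℤ] retraction K σ w b := rfl

theorem tensorBoundary_tensorRetraction (hσ : σ ∈ K.faces) (hw : w ∈ σ)
    (z : Chains K ⊗[ℤ] Chains K) :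
    tensorBoundary K (tensorRetraction K σ w z) =
      tensorRetraction K σ w (tensorBoundary K z) := by
  induction z using TensorProduct.induction_on with
  | zero => simp only [map_zero]
  | tmul a b =>
    rw [tensorRetraction_tmul, tensorBoundary_tmul, tensorBoundary_tmul, map_add,
      tensorRetraction_tmul, tensorRetraction_tmul, boundary_retraction, boundary_retraction,
      signMap_retraction hσ hw]
  | add z z' hz hz' => rw [map_add, map_add, hz, hz', map_add, map_add]

theorem tensorRetraction_eq_self (hσ : σ ∈ K.faces) (hw : w ∈ σ)
    (h : ∀ X Y, tensorCoeff K X Y z ≠ 0 → X ⊆ σ ∧ Y ⊆ σ) : tensorRetraction K σ w z = z := by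
  rw [tensor_eq_sum_terms z, map_sum]
  refine Finset.sum_congr rfl fun p hp => ?_
  obtain ⟨hX, hY⟩ := h _ _ (mem_terms.1 hp)
  rw [map_zsmul, tensorRetraction_tmul, retraction_chain_of_subset hσ hw hX,
    retraction_chain_of_subset hσ hw hY]

theorem exists_term_of_tensorCoeff_tensorRetraction_ne_zero (hσ : σ ∈ K.faces) (hw : w ∈ σ)
    (h : tensorCoeff K X Y (tensorRetraction K σ w z) ≠ 0) :
    (X ⊆ σ ∧ Y ⊆ σ) ∧ ∃ p ∈ terms z,
      (X = p.1.1.image (vertexRetraction σ w) ∧ X.card = p.1.1.card) ∧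
        Y = p.2.1.image (vertexRetraction σ w) ∧ Y.card = p.2.1.card := by
  rw [tensor_eq_sum_terms z, map_sum, map_sum] at h
  obtain ⟨p, hp, hne⟩ := Finset.exists_ne_zero_of_sum_ne_zero h
  rw [map_zsmul, map_zsmul, tensorRetraction_tmul, tensorCoeff_tmul] at hne
  have hmul := right_ne_zero_of_smul hne
  obtain ⟨hXσ, hX⟩ := eq_image_of_chainCoeff_retraction_ne_zero hσ hw p.1.2
    (left_ne_zero_of_mul hmul)
  obtain ⟨hYσ, hY⟩ := eq_image_of_chainCoeff_retraction_ne_zero hσ hw p.2.2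
    (right_ne_zero_of_mul hmul)
  exact ⟨⟨hXσ, hYσ⟩, p, hp, hX, hY⟩

/-- The map `D` followed by the retraction onto `σ`. -/
def retract (D : Chains K →ₗ[ℤ] Chains K ⊗[ℤ] Chains K) (σ : Finset V) (w : V) :
    Chains K →ₗ[ℤ] Chains K ⊗[ℤ] Chains K :=
  ((tensorRetraction K σ w).comp D.toAddMonoidHom).toIntLinearMap

theorem retract_apply (a : Chains K) : retract D σ w a = tensorRetraction K σ w (D a) := rfl

theorem homotopyFormulaAt_retract (hσ : σ ∈ K.faces) (hw : w ∈ σ) (hτ : τ ∈ K.faces)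
    (hτσ : τ ⊆ σ) (h : HomotopyFormulaAt K i D τ) :
    HomotopyFormulaAt K i (retract D σ w) τ := by
  rw [HomotopyFormulaAt, retract_apply, retract_apply, tensorBoundary_tensorRetraction hσ hw,
    ← map_zsmul, ← map_sub, h]
  refine tensorRetraction_eq_self hσ hw fun X Y hne => ?_
  have hloc : IsLocalAt (prevCoproduct K i) τ := isLocalAt_prevCoproduct hτ
  rw [map_add, map_zsmul, tensorCoeff_swap] at hne
  by_cases hXY : tensorCoeff K X Y (prevCoproduct K i (chain K τ)) = 0
  · rw [hXY, zero_add] at hne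
    have hsub := hloc Y X (right_ne_zero_of_mul (right_ne_zero_of_smul hne))
    exact ⟨hsub.2.trans hτσ, hsub.1.trans hτσ⟩
  · have hsub := hloc X Y hXY
    exact ⟨hsub.1.trans hτσ, hsub.2.trans hτσ⟩

theorem isLocalSolution_mapCoeff (hσ : σ ∈ K.faces)
    (hD : ∀ τ ∈ K.faces, τ ⊆ σ → HomotopyFormulaAt K i D τ)
    (hnorm : i = 0 → ∀ v ∈ σ, D (chain K {v}) = chain K {v} ⊗ₜ[ℤ] chain K {v})
    (hloc : ∀ τ ⊆ σ, IsLocalAt D τ) : IsLocalSolution (mapCoeff D) i σ where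
  subset := hloc
  formula τ hτ hne X hX hXne Y hY hYne :=
    have hτ' := mem_faces_of_subset hσ hτ hne
    (homotopyFormulaAt_iff hτ' (hloc τ hτ)).1 (hD τ hτ' hτ) X (mem_faces_of_subset hτ' hX hXne) Y
      (mem_faces_of_subset hτ' hY hYne)
  normalized hi v hv := by
    have hface : {v} ∈ K.faces :=
      mem_faces_of_subset hσ (Finset.singleton_subset_iff.2 hv) (Finset.singleton_nonempty v)
    rw [mapCoeff, hnorm hi v hv, tensorCoeff_tmul_chain hface hface, if_pos ⟨rfl, rfl⟩]

theorem isLocalSolution_mapCoeff_retract (hσ : σ ∈ K.faces) (hw : w ∈ σ)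
    (hD : ∀ τ ∈ K.faces, HomotopyFormulaAt K i D τ)
    (hnorm : i = 0 → ∀ v, D (chain K {v}) = chain K {v} ⊗ₜ[ℤ] chain K {v})
    (hloc : ∀ τ ⊂ σ, IsLocalAt D τ) : IsLocalSolution (mapCoeff (retract D σ w)) i σ := by
  refine isLocalSolution_mapCoeff hσ
    (fun τ hτ hτσ => homotopyFormulaAt_retract hσ hw hτ hτσ (hD τ hτ)) (fun hi v hv => ?_)
    fun τ hτ X Y hne => ?_
  · rw [retract_apply, hnorm hi v, tensorRetraction_tmul,
      retraction_chain_of_subset hσ hw (Finset.singleton_subset_iff.2 hv)]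
  · rcases hτ.eq_or_ssubset with rfl | hτ
    · exact (exists_term_of_tensorCoeff_tensorRetraction_ne_zero hσ hw hne).1
    · rw [mapCoeff, retract_apply, tensorRetraction_eq_self hσ hw] at hne
      · exact hloc τ hτ X Y hne
      · exact fun X' Y' h' => (hloc τ hτ X' Y' h').imp hτ.subset.trans' hτ.subset.trans'

theorem forall_and_injOn_of_card_le {α β : Type*} {S : Finset α} {T : Finset β} {label : β → α}
    {good : β → Prop} (h : ∀ a ∈ S, ∃ t ∈ T, good t ∧ label t = a) (hcard : T.card ≤ S.card) :
    (∀ t ∈ T, good t ∧ label t ∈ S) ∧ Set.InjOn label T := by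
  classical
  have hsub : S ⊆ (T.filter good).image label := fun a ha => by
    obtain ⟨t, ht, hgood, rfl⟩ := h a ha
    exact Finset.mem_image_of_mem label (Finset.mem_filter.2 ⟨ht, hgood⟩)
  have hfilter : T.filter good = T := Finset.eq_of_subset_of_card_le (Finset.filter_subset _ T)
    (hcard.trans ((Finset.card_le_card hsub).trans Finset.card_image_le))
  rw [hfilter] at hsub
  have himage : S = T.image label :=
    Finset.eq_of_subset_of_card_le hsub (Finset.card_image_le.trans hcard)
  exact ⟨fun t ht => ⟨Finset.filter_eq_self.1 hfilter t ht,
      himage ▸ Finset.mem_image_of_mem label ht⟩,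
    Finset.card_image_iff.1 (Finset.card_image_le.antisymm (himage ▸ hcard))⟩

theorem eq_singleton_of_card_image_vertexRetraction (hσ : σ.Nonempty) (hX : ¬ X ⊆ σ)
    (h : ∀ w ∈ σ, (X.image (vertexRetraction σ w)).card = X.card) : ∃ v ∉ σ, X = {v} := by
  obtain ⟨v, hv, hvσ⟩ := Finset.not_subset.1 hX
  have hinj : ∀ w ∈ σ, Set.InjOn (vertexRetraction σ w) X := fun w hw =>
    Finset.card_image_iff.1 (h w hw)
  refine ⟨v, hvσ, Finset.eq_singleton_iff_unique_mem.2 ⟨hv, fun y hy => ?_⟩⟩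
  by_cases hyσ : y ∈ σ
  · exact hinj y hyσ hy hv (by simp only [vertexRetraction, hvσ, hyσ, if_true, if_false])
  · obtain ⟨w, hw⟩ := hσ
    exact hinj w hw hy hv (by simp only [vertexRetraction, hvσ, hyσ, if_false])

theorem image_vertexRetraction_eq_singleton (hσ : σ.Nonempty) (hX : ¬ X ⊆ σ)
    (h : ∀ w ∈ σ, (X.image (vertexRetraction σ w)).card = X.card) :
    X.image (vertexRetraction σ w) = {w} := by
  obtain ⟨v, hv, rfl⟩ := eq_singleton_of_card_image_vertexRetraction hσ hX h
  rw [Finset.image_singleton, vertexRetraction, if_neg hv]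

theorem image_inter_image_vertexRetraction_eq_singleton (hσ : σ.Nonempty)
    (hXY : ¬ (X ⊆ σ ∧ Y ⊆ σ))
    (hX : ∀ w ∈ σ, (X.image (vertexRetraction σ w)).card = X.card)
    (hY : ∀ w ∈ σ, (Y.image (vertexRetraction σ w)).card = Y.card)
    (hne : (X.image (vertexRetraction σ w) ∩ Y.image (vertexRetraction σ w)).Nonempty) :
    X.image (vertexRetraction σ w) ∩ Y.image (vertexRetraction σ w) = {w} := by
  rw [← hne.subset_singleton_iff]
  rcases not_and_or.1 hXY with h | h
  · exact Finset.inter_subset_left.trans (image_vertexRetraction_eq_singleton hσ h hX).subset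
  · exact Finset.inter_subset_right.trans (image_vertexRetraction_eq_singleton hσ h hY).subset

-- A term that is not supported on `σ` has generating set `{w}` after the retraction with centre
-- `w`. For a second centre `w'`, the generating set `{w}` thus comes from a term supported on `σ`,
-- on which both retractions agree, and two terms would share the generating set `{w}`.
theorem subset_of_forall_exists_image_inter_image_eq {T : Finset (K.faces × K.faces)}
    (hσ : σ.Nontrivial) (hcard : T.card ≤ σ.card.choose (i + 1))
    (h : ∀ w ∈ σ, ∀ L ∈ σ.powersetCard (i + 1), ∃ p ∈ T,
      ((p.1.1.image (vertexRetraction σ w)).card = p.1.1.card ∧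
        (p.2.1.image (vertexRetraction σ w)).card = p.2.1.card) ∧
      p.1.1.image (vertexRetraction σ w) ∩ p.2.1.image (vertexRetraction σ w) = L) :
    ∀ p ∈ T, p.1.1 ⊆ σ ∧ p.2.1 ⊆ σ := by
  intro p hp
  by_contra hpσ
  have hall := fun w hw =>
    forall_and_injOn_of_card_le (h w hw) (by rwa [Finset.card_powersetCard])
  have hlabel : ∀ q ∈ T, ¬ (q.1.1 ⊆ σ ∧ q.2.1 ⊆ σ) → ∀ w ∈ σ,
      q.1.1.image (vertexRetraction σ w) ∩ q.2.1.image (vertexRetraction σ w) = {w} :=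
    fun q hq hqσ w hw => image_inter_image_vertexRetraction_eq_singleton hσ.nonempty hqσ
      (fun w' hw' => ((hall w' hw').1 q hq).1.1) (fun w' hw' => ((hall w' hw').1 q hq).1.2) <| by
        have := (Finset.mem_powersetCard.1 ((hall w hw).1 q hq).2).2
        exact Finset.card_pos.1 (by omega)
  obtain ⟨w, hw, w', hw', hww'⟩ := hσ
  have hmem : {w} ∈ σ.powersetCard (i + 1) := hlabel p hp hpσ w hw ▸ ((hall w hw).1 p hp).2
  obtain ⟨q, hq, -, hqw⟩ := h w' hw' {w} hmem
  by_cases hqσ : q.1.1 ⊆ σ ∧ q.2.1 ⊆ σ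
  · refine hpσ ((hall w hw).2 hp hq ?_ ▸ hqσ)
    refine (hlabel p hp hpσ w hw).trans ?_
    rw [← hqw]
    simp only [image_vertexRetraction_of_subset hqσ.1, image_vertexRetraction_of_subset hqσ.2]
  · exact hww' (Finset.singleton_injective (hqw.symm.trans (hlabel q hq hqσ w' hw')))

theorem IsLocalSolution.exists_term (hs : IsLocalSolution (mapCoeff D) i σ) {L : Finset V}
    (hL : L ∈ σ.powersetCard (i + 1)) :
    ∃ p ∈ terms (D (chain K σ)), p.1.1 ∪ p.2.1 = σ ∧ p.1.1 ∩ p.2.1 = L := by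
  obtain ⟨hsub, hcard⟩ := Finset.mem_powersetCard.1 hL
  obtain ⟨X, Y, hne, hXY⟩ := hs.exists_inter_eq hsub hcard
  obtain ⟨-, hX, hY⟩ := mem_faces_of_mapCoeff_ne_zero hne
  exact ⟨(⟨X, hX⟩, ⟨Y, hY⟩), mem_terms.2 hne, hXY⟩

theorem isLocalAt_of_card_terms_le (hσ : σ ∈ K.faces)
    (hD : ∀ τ ∈ K.faces, HomotopyFormulaAt K i D τ)
    (hnorm : i = 0 → ∀ v, D (chain K {v}) = chain K {v} ⊗ₜ[ℤ] chain K {v})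
    (hloc : ∀ τ ⊂ σ, IsLocalAt D τ)
    (hcard : (terms (D (chain K σ))).card ≤ σ.card.choose (i + 1)) : IsLocalAt D σ := by
  rcases (nonempty_of_mem_faces hσ).exists_eq_singleton_or_nontrivial with ⟨v, rfl⟩ | hnontrivial
  · cases i with
    | zero =>
      intro X Y hne
      rw [mapCoeff, hnorm rfl, tensorCoeff_tmul_chain hσ hσ] at hne
      obtain ⟨rfl, rfl⟩ := (ite_ne_right_iff.1 hne).1
      exact ⟨subset_rfl, subset_rfl⟩
    | succ i =>
      rw [Finset.card_singleton, Nat.choose_eq_zero_of_lt (by omega), Nat.le_zero,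
        Finset.card_eq_zero] at hcard
      exact isLocalAt_iff.2 (by simp [hcard])
  · refine isLocalAt_iff.2 (subset_of_forall_exists_image_inter_image_eq hnontrivial hcard ?_)
    intro w hw L hL
    obtain ⟨q, hq, -, rfl⟩ :=
      (isLocalSolution_mapCoeff_retract hσ hw hD hnorm hloc).exists_term hL
    obtain ⟨-, p, hp, ⟨hX, hXcard⟩, hY, hYcard⟩ :=
      exists_term_of_tensorCoeff_tensorRetraction_ne_zero hσ hw (mem_terms.1 hq)
    rw [hX] at hXcard
    rw [hY] at hYcard
    exact ⟨p, hp, ⟨hXcard, hYcard⟩, by rw [hX, hY]⟩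

end Locality

/-! ### Minimal solutions are coproducts -/

section Minimal

variable {K : PreAbstractSimplicialComplex V} {i : ℕ} {σ : Finset V} {U : Set (Finset V)}
  {D : Chains K →ₗ[ℤ] Chains K ⊗[ℤ] Chains K}

theorem isLocal_of_forall_numTerms_le (hD : HomotopyFormula K i D) (hnorm : IsNormalized K i D)
    (hcard : ∀ σ : K.faces, numTerms D σ ≤ σ.1.card.choose (i + 1)) : IsLocal D := by
  refine isLocal_iff.2 fun σ => ?_
  induction σ using Finset.strongInduction with
  | H σ ih =>
    by_cases hσ : σ ∈ K.faces
    · refine isLocalAt_of_card_terms_le hσ (homotopyFormula_iff.1 hD) hnorm.apply_chain ih ?_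
      rw [← numTerms_eq D ⟨σ, hσ⟩]
      exact hcard ⟨σ, hσ⟩
    · exact fun X Y hne => absurd (mem_faces_of_mapCoeff_ne_zero hne).1 hσ

theorem isLocalSolution_of_isLocal (hD : HomotopyFormula K i D) (hnorm : IsNormalized K i D)
    (hloc : IsLocal D) (hσ : σ ∈ K.faces) : IsLocalSolution (mapCoeff D) i σ :=
  isLocalSolution_mapCoeff hσ (fun τ hτ _ => homotopyFormula_iff.1 hD τ hτ)
    (fun hi v _ => hnorm.apply_chain hi v) fun τ _ => isLocal_iff.1 hloc τ

theorem choose_le_numTerms (hD : HomotopyFormula K i D) (hnorm : IsNormalized K i D)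
    (hloc : IsLocal D) (σ : K.faces) : σ.1.card.choose (i + 1) ≤ numTerms D σ := by
  rw [← Finset.card_powersetCard, numTerms_eq]
  refine Finset.card_le_card_of_surjOn (fun p => p.1.1 ∩ p.2.1) fun L hL => ?_
  obtain ⟨p, hp, -, hpL⟩ := (isLocalSolution_of_isLocal hD hnorm hloc σ.2).exists_term hL
  exact ⟨p, hp, hpL⟩

theorem IsLocalSolution.isMinimalAt (hs : IsLocalSolution (mapCoeff D) i σ)
    (hcard : (terms (D (chain K σ))).card ≤ σ.card.choose (i + 1)) :
    IsMinimalAt (mapCoeff D) i σ := by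
  obtain ⟨hfull, hinj⟩ := forall_and_injOn_of_card_le (fun _ hL => hs.exists_term hL)
    (hcard.trans_eq (Finset.card_powersetCard _ _).symm)
  have hterm : ∀ X Y, mapCoeff D σ X Y ≠ 0 →
      ∃ p ∈ terms (D (chain K σ)), p.1.1 = X ∧ p.2.1 = Y := fun X Y hne =>
    have hface := (mem_faces_of_mapCoeff_ne_zero hne).2
    ⟨(⟨X, hface.1⟩, ⟨Y, hface.2⟩), mem_terms.2 hne, rfl, rfl⟩
  constructor
  · intro X Y hne
    obtain ⟨p, hp, rfl, rfl⟩ := hterm X Y hne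
    exact (hfull p hp).imp_right fun h => (Finset.mem_powersetCard.1 h).2
  · intro X Y X' Y' hne hne' hinter
    obtain ⟨p, hp, rfl, rfl⟩ := hterm X Y hne
    obtain ⟨q, hq, rfl, rfl⟩ := hterm X' Y' hne'
    rw [hinj hp hq hinter]
    exact ⟨rfl, rfl⟩

theorem exists_eq_coproduct_of_isLocal (hD : HomotopyFormula K i D) (hnorm : IsNormalized K i D)
    (hloc : IsLocal D) (hcard : ∀ σ : K.faces, numTerms D σ ≤ σ.1.card.choose (i + 1)) :
    ∃ U : Set (Finset V), IsConsistent K i U ∧ D = coproduct K i U := by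
  have hs : ∀ σ ∈ K.faces, IsLocalSolution (mapCoeff D) i σ := fun σ hσ =>
    isLocalSolution_of_isLocal hD hnorm hloc hσ
  have hm : ∀ σ ∈ K.faces, ∀ τ ⊆ σ, IsMinimalAt (mapCoeff D) i τ := fun σ hσ τ hτ =>
    ((hs σ hσ).mono hτ).isMinimalAt (card_terms_chain_le (b := (Nat.choose · (i + 1))) hcard τ)
  have hF : ∀ σ ∈ K.faces, ∀ M ⊆ σ, M.Nonempty → M ∈ K.faces := fun σ hσ M =>
    mem_faces_of_subset hσ
  refine ⟨inversionSet (mapCoeff D) K.faces i, ⟨fun s h => ⟨h.1, h.2.1⟩, fun M hM hMcard => ?_⟩,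
    mapCoeff_ext fun τ hτ X _ Y _ => ?_⟩
  · exact consistentAt_inversionSet (hF M hM) (hs M hM) (hm M hM) hMcard
  · rw [mapCoeff_coproduct hτ]
    exact eq_coproductCoeff_inversionSet (hF τ hτ) (hs τ hτ) (hm τ hτ) X Y

theorem exists_eq_coproduct_of_numTerms_le (hD : HomotopyFormula K i D)
    (hnorm : IsNormalized K i D)
    (hcard : ∀ σ : K.faces, numTerms D σ ≤ σ.1.card.choose (i + 1)) :
    ∃ U : Set (Finset V), IsConsistent K i U ∧ D = coproduct K i U :=
  exists_eq_coproduct_of_isLocal hD hnorm (isLocal_of_forall_numTerms_le hD hnorm hcard) hcard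

theorem isConsistent_empty (K : PreAbstractSimplicialComplex V) (i : ℕ) : IsConsistent K i ∅ :=
  ⟨fun _ h => h.elim, fun _ _ _ => Or.inl fun _ _ _ _ _ h => h.elim⟩

theorem isLocal_coproduct (K : PreAbstractSimplicialComplex V) (i : ℕ) (U : Set (Finset V)) :
    IsLocal (coproduct K i U) := fun σ => by
  rw [← chain_coe]
  exact isLocalAt_iff.1 (isLocalAt_coproduct σ.2)

theorem initVertex_self (U : Set (Finset V)) (σ : Finset V) : initVertex U σ σ = ∅ :=
  Finset.subset_empty.1 (initVertex_subset.trans_eq (Finset.sdiff_self σ))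

theorem isNormalized_coproduct (K : PreAbstractSimplicialComplex V) (i : ℕ)
    (U : Set (Finset V)) : IsNormalized K i (coproduct K i U) := by
  rintro rfl σ hdim
  have hcard : σ.1.card = 0 + 1 := by
    have := Finset.card_pos.2 (nonempty_of_mem_faces σ.2)
    rw [dim] at hdim
    omega
  obtain ⟨v, hv⟩ := Finset.card_eq_one.1 hcard
  rw [coproduct, Finsupp.linearCombination_single, one_smul, simplexCoproduct, ← hcard,
    Finset.powersetCard_self, Finset.sum_singleton, coVertex, initVertex_self, Finset.union_empty,
    Finset.sdiff_self, Finset.union_empty, chain_coe]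
  simp [signExp, hv, Finset.filter_singleton]

theorem numTerms_coproduct_le (K : PreAbstractSimplicialComplex V) (i : ℕ) (U : Set (Finset V))
    (σ : K.faces) : numTerms (coproduct K i U) σ ≤ σ.1.card.choose (i + 1) := by
  rw [← Finset.card_powersetCard, numTerms_eq]
  have hterm : ∀ p ∈ terms (coproduct K i U (chain K σ.1)),
      p.1.1 ∩ p.2.1 ∈ σ.1.powersetCard (i + 1) ∧
        p.1.1 = p.1.1 ∩ p.2.1 ∪ initVertex U σ.1 (p.1.1 ∩ p.2.1) ∧
        p.2.1 = p.1.1 ∩ p.2.1 ∪ coVertex U σ.1 (p.1.1 ∩ p.2.1) := fun p hp => by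
    obtain ⟨hunion, hcard, hsdiff⟩ := eq_of_coproductCoeff_ne_zero <|
      (mapCoeff_coproduct σ.2).symm.trans_ne (mem_terms.1 hp)
    have hsub : p.1.1 ∩ p.2.1 ⊆ σ.1 :=
      hunion ▸ Finset.inter_subset_left.trans Finset.subset_union_left
    exact ⟨Finset.mem_powersetCard.2 ⟨hsub, hcard⟩,
      (eq_union_vertices_iff hsub).2 ⟨rfl, hunion, hsdiff⟩⟩
  refine Finset.card_le_card_of_injOn (fun p => p.1.1 ∩ p.2.1) (fun p hp => (hterm p hp).1)
    fun p hp q hq (hinter : p.1.1 ∩ p.2.1 = q.1.1 ∩ q.2.1) => Prod.ext (Subtype.ext ?_)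
      (Subtype.ext ?_)
  · rw [(hterm p hp).2.1, hinter, ← (hterm q hq).2.1]
  · rw [(hterm p hp).2.2, hinter, ← (hterm q hq).2.2]

end Minimal

end CupCoproduct

end

open CupCoproduct TensorProduct in
theorem theorem4p5_general {V : Type*} [LinearOrder V] (i : ℕ)
    (K : PreAbstractSimplicialComplex V) :
    (∀ U : Set (Finset V), IsConsistent K i U → HomotopyFormula K i (coproduct K i U)) ∧
    (∀ D : Chains K →ₗ[ℤ] Chains K ⊗[ℤ] Chains K,
      HomotopyFormula K i D → IsNormalized K i D →
      (∀ D' : Chains K →ₗ[ℤ] Chains K ⊗[ℤ] Chains K,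
        HomotopyFormula K i D' → IsNormalized K i D' → IsLocal D' →
        ∀ σ : K.faces, numTerms D σ ≤ numTerms D' σ) →
      ∃ U : Set (Finset V), IsConsistent K i U ∧ D = coproduct K i U) ∧
    (∀ [Fintype V] (D : Chains K →ₗ[ℤ] Chains K ⊗[ℤ] Chains K),
      HomotopyFormula K i D → IsNormalized K i D → IsLocal D →
      (∀ D' : Chains K →ₗ[ℤ] Chains K ⊗[ℤ] Chains K,
        HomotopyFormula K i D' → IsNormalized K i D' → IsLocal D' →
        totalTerms D ≤ totalTerms D') →
      ∃ U : Set (Finset V), IsConsistent K i U ∧ D = coproduct K i U) := by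
  have hformula := homotopyFormula_coproduct (isConsistent_empty K i)
  have hnormalized := isNormalized_coproduct K i ∅
  have hlocal := isLocal_coproduct K i ∅
  have hle := numTerms_coproduct_le K i ∅
  refine ⟨fun U hU => homotopyFormula_coproduct hU, fun D hD hnorm hmin => ?_,
    fun D hD hnorm hloc hmin => ?_⟩
  · exact exists_eq_coproduct_of_numTerms_le hD hnorm fun σ =>
      (hmin _ hformula hnormalized hlocal σ).trans (hle σ)
  · have hchoose := choose_le_numTerms hD hnorm hloc
    exact exists_eq_coproduct_of_isLocal hD hnorm hloc fun σ =>
      (numTerms_le_of_totalTerms_le (fun τ => (hle τ).trans (hchoose τ))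
        (hmin _ hformula hnormalized hlocal) σ).trans (hle σ)

theorem theorem4p5 (n i : ℕ) (K : PreAbstractSimplicialComplex (Fin (n + 1))) :
    -- every consistent set gives a solution of the homotopy formula
    (∀ U : Set (Finset (Fin (n + 1))), CupCoproduct.IsConsistent K i U →
      CupCoproduct.HomotopyFormula K i (CupCoproduct.coproduct K i U)) ∧
    -- converse, with the number of terms minimal on every simplex
    (∀ D : CupCoproduct.Chains K →ₗ[ℤ]
        TensorProduct ℤ (CupCoproduct.Chains K) (CupCoproduct.Chains K),
      CupCoproduct.HomotopyFormula K i D →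
      CupCoproduct.IsNormalized K i D →
      (∀ D' : CupCoproduct.Chains K →ₗ[ℤ]
          TensorProduct ℤ (CupCoproduct.Chains K) (CupCoproduct.Chains K),
        CupCoproduct.HomotopyFormula K i D' → CupCoproduct.IsNormalized K i D' →
        CupCoproduct.IsLocal D' →
        ∀ σ : K.faces, CupCoproduct.numTerms D σ ≤ CupCoproduct.numTerms D' σ) →
      ∃ U : Set (Finset (Fin (n + 1))),
        CupCoproduct.IsConsistent K i U ∧ D = CupCoproduct.coproduct K i U) ∧
    -- converse, with the total number of terms minimal
    (∀ D : CupCoproduct.Chains K →ₗ[ℤ]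
        TensorProduct ℤ (CupCoproduct.Chains K) (CupCoproduct.Chains K),
      CupCoproduct.HomotopyFormula K i D →
      CupCoproduct.IsNormalized K i D →
      CupCoproduct.IsLocal D →
      (∀ D' : CupCoproduct.Chains K →ₗ[ℤ]
          TensorProduct ℤ (CupCoproduct.Chains K) (CupCoproduct.Chains K),
        CupCoproduct.HomotopyFormula K i D' → CupCoproduct.IsNormalized K i D' →
        CupCoproduct.IsLocal D' →
        CupCoproduct.totalTerms D ≤ CupCoproduct.totalTerms D') →
      ∃ U : Set (Finset (Fin (n + 1))),
        CupCoproduct.IsConsistent K i U ∧ D = CupCoproduct.coproduct K i U) := by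
  obtain ⟨hsolution, hsimplexwise, htotal⟩ := theorem4p5_general i K
  exact ⟨hsolution, hsimplexwise, htotal⟩
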